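/- **Conventions.** A graph is $\Gamma=(V,D,\mathrm{beg},{}^{-1})$ with a non-empty set $V$ of vertices, a set $D$ of darts, a map $\mathrm{beg}:D\to V$ and a map $x\mapsto x^{-1}$ on $D$ with $(x^{-1})^{-1}=x$; the end of $x$ is $\mathrm{beg}(x^{-1})$. An edge is a set $\{x,x^{-1}\}$; it is a semi-edge if $x=x^{-1}$ and a loop if $x\ne x^{-1}$ and $\mathrm{beg}\,x=\mathrm{beg}\,x^{-1}$. A graph is simple if it has no semi-edges, no loops and no two distinct edges with the same endvertices; it is cubic if exactly three darts begin at each vertex. Isomorphisms and automorphisms are bijections on vertices and on darts that commute with $\mathrm{beg}$ and ${}^{-1}$. A *cyclic generalised voltage graph* $(\Delta,\lambda,\iota,\zeta)$ is a finite connected graph $\Delta$ with $\lambda:D\to\mathbb Z_{>0}$, $\iota:V\to\mathbb Z_{>0}$, $\zeta:D\to\mathbb Z$ such that, for every dart $x$, $\lambda(x)\iota(\mathrm{beg}\,x)=\lambda(x^{-1})\iota(\mathrm{beg}\,x^{-1})$ and $\zeta(x^{-1})\equiv-\zeta(x)\pmod{\lambda(x)\iota(\mathrm{beg}\,x)}$.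 Its *cyclic generalised cover* has vertices $v_i$ ($v\in V$, $i\in\mathbb Z_{\iota(v)}$), darts $x_i$ ($x\in D$, $i\in\mathbb Z_{\lambda(x)\iota(\mathrm{beg}\,x)}$), $\mathrm{beg}(x_i)=(\mathrm{beg}\,x)_i$ and $(x_i)^{-1}=(x^{-1})_{i+\zeta(x)}$. **The graphs $\Gamma_i$.** For integers $m\ge1$ and $r,s\ge0$ let $\Gamma_i(m;r,s)$ (written $\Gamma_i(m;r)$ or $\Gamma_i(m)$ if $s$, or $r$ and $s$, do not occur) be the cyclic generalised cover given by row $i$ of the list below. There the vertices are $0,1,2$ (or $0,1$, or $0$), and the bracket gives their indices $\iota$. The symbol $S_a$ is a semi-edge at $a$, with label $1$ and voltage $\iota(a)/2$. The symbol $L_a(z)$ is a loop at $a$, both of its darts having label $1$ and one having voltage $z$, the other $-z$. The symbol $ab^{p,q}(z)$ is an edge whose dart from $a$ to $b$ has label $p$ and voltage $z$ and whose inverse dart has label $q$ and voltage $-z$; $(z)$ is omitted if $z=0$, and the labels are omitted if $p=q=1$. - $\Delta_1$: $[m]$; $S_0,\ L_0(r)$. - $\Delta_2$: $[m,m]$;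 $01,\ L_0(r),\ L_1(s)$. - $\Delta_3$: $[m,m]$; $01,\ 01(r),\ S_0,\ S_1$. - $\Delta_4$: $[m,m]$; $01,\ 01(r),\ 01(s)$. - $\Delta_5$: $[m,2m]$; $01^{2,1},\ S_0,\ L_1(r)$. - $\Delta_6$: $[m,3m]$; $01^{3,1},\ L_1(r)$. - $\Delta_7$: $[m,\frac{3m}2]$; $01^{3,2},\ S_1$. - $\Delta_8$: $[m,m,2m]$; $02^{2,1},\ 12^{2,1},\ 01(r),\ S_2$. - $\Delta_9$: $[\frac m2,\frac m2,m]$; $02^{2,1},\ 12^{2,1},\ S_0,\ S_1,\ S_2$. - $\Delta_{10}$: $[m,3m,\frac{3m}2]$; $01^{3,1},\ 12^{1,2},\ S_1,\ S_2$. - $\Delta_{11}$: $[m,\frac{3m}2,\frac{3m}4]$; $01^{3,2},\ 12^{1,2},\ S_2$. - $\Delta_{12}$: $[m,2m,2m]$; $01^{2,1},\ 12,\ S_0,\ S_1,\ L_2(r)$. - $\Delta_{13}$: $[m,3m,3m]$; $01^{3,1},\ 12,\ S_1,\ L_2(r)$. - $\Delta_{14}$: $[m,\frac{3m}2,\frac{3m}2]$;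 $01^{3,2},\ 12,\ L_2(r)$. - $\Delta_{15}$: $[\frac m3,\frac m3,m]$; $02^{3,1},\ 12^{3,1},\ S_2$. - $\Delta_{16}$: $[m,2m,3m]$; $02^{3,1},\ 12^{3,2}$. - $\Delta_{17}$: $[m,m,2m]$; $01,\ 12^{2,1},\ L_0(r),\ L_2(s)$. - $\Delta_{18}$: $[m,2m,4m]$; $01^{2,1},\ 12^{2,1},\ S_0,\ L_2(r)$. - $\Delta_{19}$: $[m,3m,6m]$; $01^{3,1},\ 12^{2,1},\ L_2(r)$. - $\Delta_{20}$: $[m,3m,3m]$; $01^{3,1},\ 12,\ 12(r),\ S_2$. - $\Delta_{21}$: $[m,2m,2m]$; $01^{2,1},\ 12,\ 12(r),\ S_0,\ S_2$. - $\Delta_{22}$: $[m,m,m]$; $01,\ 12,\ 01(r),\ S_0,\ L_2(s)$. - $\Delta_{23}$: $[m,m,m]$; $01,\ 12,\ 02(r),\ 02(s),\ S_1$. - $\Delta_{24}$: $[m,m,m]$; $01,\ 12,\ 02(r),\ S_0,\ S_1,\ S_2$. - $\Delta_{25}$: $[m,m,m]$; $01,\ 12,\ L_0(r),\ S_1,\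 L_2(s)$. Voltages are always taken *reduced*: $0\le z<\gcd(\iota(a),\iota(b))$ for an edge $ab^{p,q}(z)$, and $0<z<\iota(a)$, $z\neq\iota(a)/2$ for a loop $L_a(z)$. **Theorem.** A graph $\Gamma$ is a finite, connected, cubic, simple graph with a cyclic group of automorphisms $G\le\mathrm{Aut}(\Gamma)$ having at most $3$ orbits on vertices if and only if it is isomorphic to one of the following, with $m\geq 1$ and reduced voltages: 1. $\Gamma_7(4)$, $\Gamma_9(4)$, $\Gamma_{10}(4)$, $\Gamma_{11}(8)$, $\Gamma_{15}(6)$ or $\Gamma_{16}(1)$; 2. $\Gamma_1(m;r)$ with $m$ even, $m\ge4$, $r\ne0$, $\gcd(\frac m2,r)=1$; 3. $\Gamma_i(m;r)$ with $i\in\{3,12,13,14,18,20,21\}$, $m$ even, $r\neq0$, $\gcd(\frac m2,r)=1$; 4. $\Gamma_i(m;r)$ with $i\in\{6,19\}$, $r\ne0$, $\gcd(m,r)=1$; 5. $\Gamma_8(m;r)$ with $\gcd(m,r)=1$; 6. $\Gamma_i(m;r,s)$ with $i\in\{2,17\}$, $m\ge3$, $r\ne0\ne s$, $\gcd(m,r,s)=1$;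 7. $\Gamma_4(m;r,s)$ with $m\ge3$, $0<r<s$, $\gcd(m,r,s)=1$; 8. $\Gamma_5(m;r)$ with $m$ even, $r\ne0$, $\gcd(\frac m2,r)=1$; 9. $\Gamma_{23}(m;r,s)$ with $m$ even, $r\ne s$, $\gcd(\frac m2,r,s)=1$; 10. $\Gamma_{24}(m;r)$ with $m$ even, $\gcd(\frac m2,r)=1$; 11. $\Gamma_i(m;r,s)$ with $i\in\{22,25\}$, $m$ even, $m\ge4$, $r\ne0\ne s$, $\gcd(\frac m2,r,s)=1$. -/

import Mathlib

universe u v u' v'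

/-- A graph in the sense of covering theory: vertices, darts, the initial vertex of a dart and the
inverse of a dart.  Multiple edges, loops and semi-edges are allowed. -/
structure DartGraph : Type (max (u + 1) (v + 1)) where
  V : Type u
  D : Type v
  beg : D → V
  inv : D → D
  inv_inv : ∀ x, inv (inv x) = x
  nonempty : Nonempty V

namespace DartGraph

/-- The end of a dart. -/
def term (Γ : DartGraph.{u, v}) (x : Γ.D) : Γ.V := Γ.beg (Γ.inv x)

/-- There is a dart from `a` to `b`. -/
def Linked (Γ : DartGraph.{u, v}) (a b : Γ.V) : Prop := ∃ x : Γ.D, Γ.beg x = a ∧ Γ.term x = b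

/-- Any two vertices are joined by a walk. -/
def Connected (Γ : DartGraph.{u, v}) : Prop := ∀ a b : Γ.V, Relation.ReflTransGen Γ.Linked a b

/-- Every vertex has valence three. -/
def IsCubic (Γ : DartGraph.{u, v}) : Prop := ∀ a : Γ.V, Nat.card {x : Γ.D // Γ.beg x = a} = 3

/-- No semi-edges, no loops, and no two distinct parallel edges. -/
def IsSimple (Γ : DartGraph.{u, v}) : Prop :=
  (∀ x : Γ.D, Γ.inv x ≠ x) ∧
  (∀ x : Γ.D, Γ.term x ≠ Γ.beg x) ∧
  (∀ x y : Γ.D, Γ.beg x = Γ.beg y → Γ.term x = Γ.term y → y = x ∨ y = Γ.inv x)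

/-- Isomorphisms of graphs: bijections on vertices and on darts that commute with `beg`
and `inv`. -/
structure Iso (Γ : DartGraph.{u, v}) (Δ : DartGraph.{u', v'}) where
  onV : Γ.V ≃ Δ.V
  onD : Γ.D ≃ Δ.D
  map_beg : ∀ x, onV (Γ.beg x) = Δ.beg (onD x)
  map_inv : ∀ x, onD (Γ.inv x) = Δ.inv (onD x)

/-- The automorphism group, acting on vertices and darts. -/
def Aut (Γ : DartGraph.{u, v}) : Subgroup (Equiv.Perm Γ.V × Equiv.Perm Γ.D) where
  carrier := {p | ∀ x, p.1 (Γ.beg x) = Γ.beg (p.2 x) ∧ p.2 (Γ.inv x) = Γ.inv (p.2 x)}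
  one_mem' := fun x => ⟨rfl, rfl⟩
  mul_mem' := by
    intro p q hp hq x
    refine ⟨?_, ?_⟩
    · simp [(hq x).1, (hp (q.2 x)).1]
    · simp [(hq x).2, (hp (q.2 x)).2]
  inv_mem' := by
    intro p hp x
    refine ⟨?_, ?_⟩
    · have h := (hp (p.2⁻¹ x)).1
      simp only [← Equiv.Perm.mul_apply, mul_inv_cancel, Equiv.Perm.one_apply] at h
      simp only [Prod.fst_inv, Prod.snd_inv]
      rw [Equiv.Perm.inv_eq_iff_eq]
      exact h.symm
    · have h := (hp (p.2⁻¹ x)).2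
      simp only [← Equiv.Perm.mul_apply, mul_inv_cancel, Equiv.Perm.one_apply] at h
      simp only [Prod.snd_inv]
      rw [Equiv.Perm.inv_eq_iff_eq]
      exact h.symm

/-- The action of the automorphism group on the vertices. -/
instance (Γ : DartGraph.{u, v}) : MulAction Γ.Aut Γ.V where
  smul g a := g.1.1 a
  one_smul _ := rfl
  mul_smul _ _ _ := rfl

end DartGraph

/-- A cyclic generalised voltage graph `(Δ, λ, ι, ζ)`: a finite connected graph with a positive
dart-labelling `lam`, a positive index function `iota` and a voltage assignment `zeta`. -/
structure CyclicVoltageGraph where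
  Δ : DartGraph.{0, 0}
  finite_V : Finite Δ.V
  finite_D : Finite Δ.D
  connected : Δ.Connected
  lam : Δ.D → ℕ
  lam_pos : ∀ x, 0 < lam x
  iota : Δ.V → ℕ
  iota_pos : ∀ a, 0 < iota a
  ratio : ∀ x, lam x * iota (Δ.beg x) = lam (Δ.inv x) * iota (Δ.term x)
  zeta : Δ.D → ℤ
  zeta_inv : ∀ x, zeta (Δ.inv x) ≡ -zeta x [ZMOD ((lam x * iota (Δ.beg x) : ℕ) : ℤ)]

namespace CyclicVoltageGraph

/-- The inverse of the dart `x_i` of the cover is `(x⁻¹)_{i + ζ(x)}`. -/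
def coverInv (C : CyclicVoltageGraph)
    (p : Σ x : C.Δ.D, ZMod (C.lam x * C.iota (C.Δ.beg x))) :
    Σ x : C.Δ.D, ZMod (C.lam x * C.iota (C.Δ.beg x)) :=
  ⟨C.Δ.inv p.1,
    ZMod.castHom (C.ratio p.1).symm.dvd (ZMod (C.lam (C.Δ.inv p.1) * C.iota (C.Δ.term p.1))) p.2
      + (C.zeta p.1 : ZMod (C.lam (C.Δ.inv p.1) * C.iota (C.Δ.term p.1)))⟩

theorem coverInv_coverInv (C : CyclicVoltageGraph)
    (p : Σ x : C.Δ.D, ZMod (C.lam x * C.iota (C.Δ.beg x))) :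
    C.coverInv (C.coverInv p) = p := by
  obtain ⟨x, i⟩ := p
  have key : ∀ (y : C.Δ.D) (hy : y = x)
      (hd : C.lam y * C.iota (C.Δ.beg y) ∣ C.lam x * C.iota (C.Δ.beg x)),
      (⟨y, ZMod.castHom hd (ZMod (C.lam y * C.iota (C.Δ.beg y))) i⟩ :
        Σ x : C.Δ.D, ZMod (C.lam x * C.iota (C.Δ.beg x))) = ⟨x, i⟩ := by
    intro y hy hd
    subst hy
    simp
  have hinv := C.Δ.inv_inv x
  have hd : C.lam (C.Δ.inv (C.Δ.inv x)) * C.iota (C.Δ.beg (C.Δ.inv (C.Δ.inv x))) =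
      C.lam x * C.iota (C.Δ.beg x) := by rw [hinv]
  refine Eq.trans ?_ (key _ hinv hd.dvd)
  refine congrArg (Sigma.mk (C.Δ.inv (C.Δ.inv x))) ?_
  have hd2 : C.lam (C.Δ.inv (C.Δ.inv x)) * C.iota (C.Δ.beg (C.Δ.inv (C.Δ.inv x))) ∣
      C.lam (C.Δ.inv x) * C.iota (C.Δ.beg (C.Δ.inv x)) := (C.ratio (C.Δ.inv x)).symm.dvd
  have hd1 : C.lam (C.Δ.inv x) * C.iota (C.Δ.beg (C.Δ.inv x)) ∣
      C.lam x * C.iota (C.Δ.beg x) := (C.ratio x).symm.dvd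
  change ZMod.castHom hd2 (ZMod (C.lam (C.Δ.inv (C.Δ.inv x)) *
        C.iota (C.Δ.beg (C.Δ.inv (C.Δ.inv x)))))
      (ZMod.castHom hd1 (ZMod (C.lam (C.Δ.inv x) * C.iota (C.Δ.beg (C.Δ.inv x)))) i
        + ((C.zeta x : ℤ) : ZMod (C.lam (C.Δ.inv x) * C.iota (C.Δ.beg (C.Δ.inv x)))))
      + ((C.zeta (C.Δ.inv x) : ℤ) : ZMod (C.lam (C.Δ.inv (C.Δ.inv x)) *
        C.iota (C.Δ.beg (C.Δ.inv (C.Δ.inv x))))) = ZMod.castHom hd.dvd _ i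
  rw [map_add, map_intCast, add_assoc]
  have hz : ((C.zeta x : ℤ) : ZMod (C.lam (C.Δ.inv (C.Δ.inv x)) *
      C.iota (C.Δ.beg (C.Δ.inv (C.Δ.inv x))))) + ((C.zeta (C.Δ.inv x) : ℤ) : ZMod _) = 0 := by
    rw [hd, ← Int.cast_add, ZMod.intCast_zmod_eq_zero_iff_dvd]
    have h := (C.zeta_inv x).symm.dvd
    have e : C.zeta x + C.zeta (C.Δ.inv x) = C.zeta (C.Δ.inv x) - -C.zeta x := by ring
    rw [e]
    exact h
  rw [hz, add_zero]
  exact DFunLike.congr_fun (Subsingleton.elim ((ZMod.castHom hd2 _).comp (ZMod.castHom hd1 _))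
    (ZMod.castHom hd.dvd _)) i

/-- The cyclic generalised cover `CycCov(Δ, λ, ι, ζ)`. -/
def cover (C : CyclicVoltageGraph) : DartGraph.{0, 0} where
  V := Σ a : C.Δ.V, ZMod (C.iota a)
  D := Σ x : C.Δ.D, ZMod (C.lam x * C.iota (C.Δ.beg x))
  beg p := ⟨C.Δ.beg p.1, ZMod.castHom (Dvd.intro_left _ rfl) (ZMod (C.iota (C.Δ.beg p.1))) p.2⟩
  inv := C.coverInv
  inv_inv := C.coverInv_coverInv
  nonempty := C.Δ.nonempty.elim fun a => ⟨⟨a, 0⟩⟩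

end CyclicVoltageGraph

/-- An edge of a drawn diagram with vertices `Fin n`.  A semi-edge and a loop have labels `1`; the
loop at `a` has one dart of voltage `z`; `link a b p q z` is an edge whose dart from `a` to `b` has
label `p` and voltage `z` and whose dart from `b` to `a` has label `q`. -/
inductive DEdge (n : ℕ) : Type
  | semi (a : Fin n)
  | loop (a : Fin n) (z : ℕ)
  | link (a b : Fin n) (p q : ℕ) (z : ℕ)

namespace DEdge

/-- The darts underlying an edge; `true` stands for the reversed dart. -/
def Dir {n : ℕ} : DEdge n → Type
  | semi _ => Unit
  | loop _ _ => Bool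
  | link _ _ _ _ _ => Bool

def beg {n : ℕ} : (e : DEdge n) → e.Dir → Fin n
  | semi a, _ => a
  | loop a _, _ => a
  | link a _ _ _ _, false => a
  | link _ b _ _ _, true => b

def inv {n : ℕ} : (e : DEdge n) → e.Dir → e.Dir
  | semi _, d => d
  | loop _ _, d => Bool.not d
  | link _ _ _ _ _, d => Bool.not d

def lam {n : ℕ} : (e : DEdge n) → e.Dir → ℕ
  | semi _, _ => 1
  | loop _ _, _ => 1
  | link _ _ p _ _, false => p
  | link _ _ _ q _, true => q

/-- The voltage of a dart; a semi-edge at `a` has voltage `ι(a)/2`. -/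
def zeta {n : ℕ} (iota : Fin n → ℕ) : (e : DEdge n) → e.Dir → ℤ
  | semi a, _ => ((iota a / 2 : ℕ) : ℤ)
  | loop _ z, false => z
  | loop _ z, true => -z
  | link _ _ _ _ z, false => z
  | link _ _ _ _ z, true => -z

/-- The edge satisfies the requirements of a cyclic generalised voltage graph. -/
def Valid {n : ℕ} (iota : Fin n → ℕ) : DEdge n → Prop
  | semi a => Even (iota a)
  | loop _ _ => True
  | link a b p q _ => 0 < p ∧ 0 < q ∧ p * iota a = q * iota b

/-- The voltage of the edge is reduced: `0 ≤ z < gcd(ι(a), ι(b))` for an edge between `a` and `b`,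
and moreover `z ≠ 0` and `z ≠ ι(a)/2` for a loop at `a`. -/
def Reduced {n : ℕ} (iota : Fin n → ℕ) : DEdge n → Prop
  | semi _ => True
  | loop a z => 0 < z ∧ z < iota a ∧ 2 * z ≠ iota a
  | link a b _ _ z => z < Nat.gcd (iota a) (iota b)

def joins {n : ℕ} (c a : Fin n) : DEdge n → Prop
  | semi _ => False
  | loop _ _ => False
  | link a' b' _ _ _ => (a' = c ∧ b' = a) ∨ (a' = a ∧ b' = c)

theorem inv_inv {n : ℕ} (e : DEdge n) (d : e.Dir) : e.inv (e.inv d) = d := by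
  cases e
  · rfl
  · exact Bool.not_not d
  · exact Bool.not_not d

instance {n : ℕ} (e : DEdge n) : Finite e.Dir := by
  cases e
  · exact inferInstanceAs (Finite Unit)
  · exact inferInstanceAs (Finite Bool)
  · exact inferInstanceAs (Finite Bool)

end DEdge

/-- A drawn diagram: vertices `Fin n`, a list of edges, and the index function. -/
structure Diagram where
  n : ℕ
  iota : Fin n → ℕ
  edges : List (DEdge n)

namespace Diagram

structure Valid (d : Diagram) : Prop where
  iota_pos : ∀ a, 0 < d.iota a
  edges_valid : ∀ e ∈ d.edges, e.Valid d.iota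
  centre : ∃ c, ∀ a, a = c ∨ ∃ e ∈ d.edges, e.joins c a

def Reduced (d : Diagram) : Prop := ∀ e ∈ d.edges, e.Reduced d.iota

/-- The underlying graph of a diagram. -/
def graph (d : Diagram) (h : Nonempty (Fin d.n)) : DartGraph.{0, 0} where
  V := Fin d.n
  D := Σ k : Fin d.edges.length, (d.edges.get k).Dir
  beg x := (d.edges.get x.1).beg x.2
  inv x := ⟨x.1, (d.edges.get x.1).inv x.2⟩
  inv_inv x := by simp [DEdge.inv_inv]
  nonempty := h

theorem Valid.nonempty {d : Diagram} (h : d.Valid) : Nonempty (Fin d.n) :=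
  h.centre.elim fun c _ => ⟨c⟩

theorem linked_of_joins {d : Diagram} (h : Nonempty (Fin d.n)) {c a : Fin d.n} {e : DEdge d.n}
    (he : e ∈ d.edges) (hj : e.joins c a) :
    (d.graph h).Linked c a ∧ (d.graph h).Linked a c := by
  obtain ⟨k, rfl⟩ := List.get_of_mem he
  have main : ∀ e' : DEdge d.n, e'.joins c a →
      (∃ s : e'.Dir, e'.beg s = c ∧ e'.beg (e'.inv s) = a) ∧
      (∃ s : e'.Dir, e'.beg s = a ∧ e'.beg (e'.inv s) = c) := by
    intro e' h'
    cases e' with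
    | semi _ => exact h'.elim
    | loop _ _ => exact h'.elim
    | link a' b' p q z =>
      rcases h' with ⟨rfl, rfl⟩ | ⟨rfl, rfl⟩
      · exact ⟨⟨false, rfl, rfl⟩, ⟨true, rfl, rfl⟩⟩
      · exact ⟨⟨true, rfl, rfl⟩, ⟨false, rfl, rfl⟩⟩
  obtain ⟨⟨s, hs⟩, ⟨t, ht⟩⟩ := main _ hj
  exact ⟨⟨⟨k, s⟩, hs⟩, ⟨⟨k, t⟩, ht⟩⟩

theorem Valid.connected {d : Diagram} (h : d.Valid) : (d.graph h.nonempty).Connected := by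
  obtain ⟨c, hc⟩ := h.centre
  have to_c : ∀ a, Relation.ReflTransGen (d.graph h.nonempty).Linked a c := by
    intro a
    rcases hc a with rfl | ⟨e, he, hj⟩
    · exact .refl
    · exact .single (linked_of_joins h.nonempty he hj).2
  have of_c : ∀ a, Relation.ReflTransGen (d.graph h.nonempty).Linked c a := by
    intro a
    rcases hc a with rfl | ⟨e, he, hj⟩
    · exact .refl
    · exact .single (linked_of_joins h.nonempty he hj).1
  exact fun a b => (to_c a).trans (of_c b)

theorem _root_.DEdge.lam_pos {n : ℕ} {iota : Fin n → ℕ} (e : DEdge n) (h : e.Valid iota)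
    (s : e.Dir) : 0 < e.lam s := by
  cases e with
  | semi _ => exact Nat.one_pos
  | loop _ _ => exact Nat.one_pos
  | link a b p q z =>
    obtain ⟨hp, hq, _⟩ := h
    cases s
    · exact hp
    · exact hq

theorem _root_.DEdge.ratio {n : ℕ} {iota : Fin n → ℕ} (e : DEdge n) (h : e.Valid iota)
    (s : e.Dir) :
    e.lam s * iota (e.beg s) = e.lam (e.inv s) * iota (e.beg (e.inv s)) := by
  cases e with
  | semi _ => rfl
  | loop _ _ => rfl
  | link a b p q z =>
    obtain ⟨_, _, hpq⟩ := h
    cases s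
    · exact hpq
    · exact hpq.symm

theorem _root_.DEdge.zeta_inv {n : ℕ} {iota : Fin n → ℕ} (e : DEdge n) (h : e.Valid iota)
    (s : e.Dir) :
    e.zeta iota (e.inv s) ≡ -e.zeta iota s [ZMOD ((e.lam s * iota (e.beg s) : ℕ) : ℤ)] := by
  cases e with
  | semi a =>
    obtain ⟨k, hk⟩ := h
    refine (Int.modEq_iff_dvd).2 ⟨-1, ?_⟩
    simp only [DEdge.zeta, DEdge.lam, DEdge.beg]
    omega
  | loop a z => cases s <;> simp [DEdge.zeta, DEdge.inv, Int.ModEq.refl]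
  | link a b p q z => cases s <;> simp [DEdge.zeta, DEdge.inv, Int.ModEq.refl]

theorem valid_one {a : ℕ} {es : List (DEdge 1)} (ha : 0 < a)
    (h : es.Forall (DEdge.Valid ![a])) : Valid ⟨1, ![a], es⟩ where
  iota_pos := fun i => match i with
    | 0 => ha
  edges_valid := List.forall_iff_forall_mem.1 h
  centre := ⟨(0 : Fin 1), fun i => Or.inl (Subsingleton.elim (α := Fin 1) i 0)⟩

theorem valid_two {a b p q z : ℕ} {es : List (DEdge 2)} (ha : 0 < a) (hb : 0 < b)
    (h : (.link 0 1 p q z :: es : List (DEdge 2)).Forall (DEdge.Valid ![a, b])) :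
    Valid ⟨2, ![a, b], .link 0 1 p q z :: es⟩ where
  iota_pos := fun i => match i with
    | 0 => ha
    | 1 => hb
  edges_valid := List.forall_iff_forall_mem.1 h
  centre := ⟨(0 : Fin 2), fun i => match i with
    | 0 => Or.inl rfl
    | 1 => Or.inr ⟨_, List.mem_cons_self, Or.inl ⟨rfl, rfl⟩⟩⟩

theorem valid_three {a b c p q z p' q' z' : ℕ} {es : List (DEdge 3)}
    (ha : 0 < a) (hb : 0 < b) (hc : 0 < c)
    (h : (.link 0 1 p q z :: .link 1 2 p' q' z' :: es : List (DEdge 3)).Forall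
      (DEdge.Valid ![a, b, c])) :
    Valid ⟨3, ![a, b, c], .link 0 1 p q z :: .link 1 2 p' q' z' :: es⟩ where
  iota_pos := fun i => match i with
    | 0 => ha
    | 1 => hb
    | 2 => hc
  edges_valid := List.forall_iff_forall_mem.1 h
  centre := ⟨(1 : Fin 3), fun i => match i with
    | 0 => Or.inr ⟨_, List.mem_cons_self, Or.inr ⟨rfl, rfl⟩⟩
    | 1 => Or.inl rfl
    | 2 => Or.inr ⟨_, List.mem_cons_of_mem _ List.mem_cons_self, Or.inl ⟨rfl, rfl⟩⟩⟩

theorem valid_three' {a b c p q z p' q' z' : ℕ} {es : List (DEdge 3)}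
    (ha : 0 < a) (hb : 0 < b) (hc : 0 < c)
    (h : (.link 0 2 p q z :: .link 1 2 p' q' z' :: es : List (DEdge 3)).Forall
      (DEdge.Valid ![a, b, c])) :
    Valid ⟨3, ![a, b, c], .link 0 2 p q z :: .link 1 2 p' q' z' :: es⟩ where
  iota_pos := fun i => match i with
    | 0 => ha
    | 1 => hb
    | 2 => hc
  edges_valid := List.forall_iff_forall_mem.1 h
  centre := ⟨(2 : Fin 3), fun i => match i with
    | 0 => Or.inr ⟨_, List.mem_cons_self, Or.inr ⟨rfl, rfl⟩⟩
    | 1 => Or.inr ⟨_, List.mem_cons_of_mem _ List.mem_cons_self, Or.inr ⟨rfl, rfl⟩⟩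
    | 2 => Or.inl rfl⟩

/-- The cyclic generalised voltage graph depicted by a diagram. -/
def voltageGraph (d : Diagram) (h : d.Valid) : CyclicVoltageGraph where
  Δ := d.graph h.nonempty
  finite_V := inferInstanceAs (Finite (Fin d.n))
  finite_D := inferInstanceAs (Finite (Σ k : Fin d.edges.length, (d.edges.get k).Dir))
  connected := h.connected
  lam x := (d.edges.get x.1).lam x.2
  lam_pos x := (d.edges.get x.1).lam_pos (h.edges_valid _ (d.edges.get_mem x.1)) x.2
  iota := d.iota
  iota_pos := h.iota_pos
  ratio x := (d.edges.get x.1).ratio (h.edges_valid _ (d.edges.get_mem x.1)) x.2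
  zeta x := (d.edges.get x.1).zeta d.iota x.2
  zeta_inv x := (d.edges.get x.1).zeta_inv (h.edges_valid _ (d.edges.get_mem x.1)) x.2

end Diagram

open DEdge in
/-- The 25 diagrams, drawn with parameters `m`, `r`, `s`; `m` is the index of the
distinguished vertex. -/
def diagram (i m r s : ℕ) : Diagram :=
  match i with
  | 1 => ⟨1, ![m], [semi 0, loop 0 r]⟩
  | 2 => ⟨2, ![m, m], [link 0 1 1 1 0, loop 0 r, loop 1 s]⟩
  | 3 => ⟨2, ![m, m], [link 0 1 1 1 0, link 0 1 1 1 r, semi 0, semi 1]⟩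
  | 4 => ⟨2, ![m, m], [link 0 1 1 1 0, link 0 1 1 1 r, link 0 1 1 1 s]⟩
  | 5 => ⟨2, ![m, 2 * m], [link 0 1 2 1 0, semi 0, loop 1 r]⟩
  | 6 => ⟨2, ![m, 3 * m], [link 0 1 3 1 0, loop 1 r]⟩
  | 7 => ⟨2, ![m, 3 * m / 2], [link 0 1 3 2 0, semi 1]⟩
  | 8 => ⟨3, ![m, m, 2 * m], [link 0 2 2 1 0, link 1 2 2 1 0, link 0 1 1 1 r, semi 2]⟩
  | 9 => ⟨3, ![m / 2, m / 2, m], [link 0 2 2 1 0, link 1 2 2 1 0, semi 0, semi 1, semi 2]⟩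
  | 10 => ⟨3, ![m, 3 * m, 3 * m / 2], [link 0 1 3 1 0, link 1 2 1 2 0, semi 1, semi 2]⟩
  | 11 => ⟨3, ![m, 3 * m / 2, 3 * m / 4], [link 0 1 3 2 0, link 1 2 1 2 0, semi 2]⟩
  | 12 => ⟨3, ![m, 2 * m, 2 * m],
      [link 0 1 2 1 0, link 1 2 1 1 0, semi 0, semi 1, loop 2 r]⟩
  | 13 => ⟨3, ![m, 3 * m, 3 * m], [link 0 1 3 1 0, link 1 2 1 1 0, semi 1, loop 2 r]⟩
  | 14 => ⟨3, ![m, 3 * m / 2, 3 * m / 2], [link 0 1 3 2 0, link 1 2 1 1 0, loop 2 r]⟩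
  | 15 => ⟨3, ![m / 3, m / 3, m], [link 0 2 3 1 0, link 1 2 3 1 0, semi 2]⟩
  | 16 => ⟨3, ![m, 2 * m, 3 * m], [link 0 2 3 1 0, link 1 2 3 2 0]⟩
  | 17 => ⟨3, ![m, m, 2 * m], [link 0 1 1 1 0, link 1 2 2 1 0, loop 0 r, loop 2 s]⟩
  | 18 => ⟨3, ![m, 2 * m, 4 * m], [link 0 1 2 1 0, link 1 2 2 1 0, semi 0, loop 2 r]⟩
  | 19 => ⟨3, ![m, 3 * m, 6 * m], [link 0 1 3 1 0, link 1 2 2 1 0, loop 2 r]⟩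
  | 20 => ⟨3, ![m, 3 * m, 3 * m],
      [link 0 1 3 1 0, link 1 2 1 1 0, link 1 2 1 1 r, semi 2]⟩
  | 21 => ⟨3, ![m, 2 * m, 2 * m],
      [link 0 1 2 1 0, link 1 2 1 1 0, link 1 2 1 1 r, semi 0, semi 2]⟩
  | 22 => ⟨3, ![m, m, m],
      [link 0 1 1 1 0, link 1 2 1 1 0, link 0 1 1 1 r, semi 0, loop 2 s]⟩
  | 23 => ⟨3, ![m, m, m],
      [link 0 1 1 1 0, link 1 2 1 1 0, link 0 2 1 1 r, link 0 2 1 1 s, semi 1]⟩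
  | 24 => ⟨3, ![m, m, m],
      [link 0 1 1 1 0, link 1 2 1 1 0, link 0 2 1 1 r, semi 0, semi 1, semi 2]⟩
  | 25 => ⟨3, ![m, m, m],
      [link 0 1 1 1 0, link 1 2 1 1 0, loop 0 r, semi 1, loop 2 s]⟩
  | _ => ⟨0, ![], []⟩

/-- The listed conditions on the parameters of the `i`-th diagram. -/
def ParameterConditions (i m r s : ℕ) : Prop :=
  match i with
  | 7 => m = 4
  | 9 => m = 4
  | 10 => m = 4
  | 11 => m = 8
  | 15 => m = 6
  | 16 => m = 1
  | 1 => Even m ∧ 4 ≤ m ∧ r ≠ 0 ∧ Nat.gcd (m / 2) r = 1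
  | 3 | 5 | 12 | 13 | 14 | 18 | 20 | 21 => Even m ∧ r ≠ 0 ∧ Nat.gcd (m / 2) r = 1
  | 6 | 19 => r ≠ 0 ∧ Nat.gcd m r = 1
  | 8 => Nat.gcd m r = 1
  | 2 | 17 => 3 ≤ m ∧ r ≠ 0 ∧ s ≠ 0 ∧ Nat.gcd m (Nat.gcd r s) = 1
  | 4 => 3 ≤ m ∧ 0 < r ∧ r < s ∧ Nat.gcd m (Nat.gcd r s) = 1
  | 23 => Even m ∧ r ≠ s ∧ Nat.gcd (m / 2) (Nat.gcd r s) = 1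
  | 24 => Even m ∧ Nat.gcd (m / 2) r = 1
  | 22 | 25 => Even m ∧ 4 ≤ m ∧ r ≠ 0 ∧ s ≠ 0 ∧ Nat.gcd (m / 2) (Nat.gcd r s) = 1
  | _ => False

/-- The index `m` is positive, the listed conditions hold, and all voltages are reduced. -/
structure Admissible (i m r s : ℕ) : Prop where
  pos : 0 < m
  conditions : ParameterConditions i m r s
  reduced : (diagram i m r s).Reduced

theorem diagram_valid {i m r s : ℕ} (h : Admissible i m r s) : (diagram i m r s).Valid := by
  obtain ⟨hm, hc, -⟩ := h
  unfold ParameterConditions at hc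
  split at hc
  all_goals first
    | exact hc.elim
    | first
      | refine Diagram.valid_one ?_ ?_
      | refine Diagram.valid_two ?_ ?_ ?_
      | refine Diagram.valid_three ?_ ?_ ?_ ?_
      | refine Diagram.valid_three' ?_ ?_ ?_ ?_
  all_goals
    try simp only [Nat.even_iff] at hc
    first
    | omega
    | (simp [DEdge.Valid, Nat.even_iff]; done)
    | (simp [DEdge.Valid, Nat.even_iff]; omega)

/-- The graph `Γ_i(m; r, s)`. -/
def gammaGraph (i m r s : ℕ) (h : Admissible i m r s) : DartGraph.{0, 0} :=
  ((diagram i m r s).voltageGraph (diagram_valid h)).cover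

/-!
A graph with a cyclic group of automorphisms generated by `p` is the generalised cover of its
quotient: the index of a vertex of the quotient is the length of the corresponding orbit, and the
voltages record how the shift by `p` of chosen representatives meets the edges. Conversely, a
generalised cover is acted on by the shift of its indices, with one orbit for each vertex of the
diagram.

Whether a cover is cubic and simple can be read off from the labels and voltages at each vertex of
the diagram. It is connected if and only if no integer `N > 1` divides all the indices and voltages
of the diagram once the voltages on a spanning star are normalised to `0`; this is where the gcd
conditions come from.

For the classification, let `d(a, b)` be the number of neighbours of `a` in the orbit of `b`. Then
`∑ d(a, b) = 3` over the orbits `b`, and counting edges between two orbits gives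
`d(a, b) |a| = d(b, a) |b|`, where `|a|` is the length of the orbit of `a`. With at most three
orbits these relations leave only the 25 diagrams.
-/

section Orbits

open Finset

variable {G α ι : Type*} [Group G] [MulAction G α] {p : G} {a b c : α} {w : ι → α}

/-- Two points are in the same orbit of the cyclic group generated by `p`. -/
def SameOrbit (p : G) (a b : α) : Prop := ∃ k : ℤ, p ^ k • a = b

namespace SameOrbit

theorem refl (p : G) (a : α) : SameOrbit p a a := ⟨0, by rw [zpow_zero, one_smul]⟩

theorem symm (h : SameOrbit p a b) : SameOrbit p b a := by
  obtain ⟨k, rfl⟩ := h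
  exact ⟨-k, by rw [zpow_neg, inv_smul_smul]⟩

theorem trans (h : SameOrbit p a b) (h' : SameOrbit p b c) : SameOrbit p a c := by
  obtain ⟨k, rfl⟩ := h
  obtain ⟨l, rfl⟩ := h'
  exact ⟨l + k, by rw [zpow_add, mul_smul]⟩

theorem zpow_smul (p : G) (a : α) (k : ℤ) : SameOrbit p a (p ^ k • a) := ⟨k, rfl⟩

theorem pow_smul (p : G) (a : α) (k : ℕ) : SameOrbit p a (p ^ k • a) :=
  ⟨k, by rw [zpow_natCast]⟩

end SameOrbit

theorem sameOrbit_iff_orbitRel :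
    SameOrbit p a b ↔ MulAction.orbitRel (Subgroup.zpowers p) α a b := by
  rw [MulAction.orbitRel_apply]
  constructor
  · rintro ⟨k, rfl⟩
    exact ⟨⟨p ^ (-k), -k, rfl⟩, by simp [Subgroup.smul_def]⟩
  · rintro ⟨⟨_, k, rfl⟩, rfl⟩
    exact (SameOrbit.zpow_smul p b k).symm

theorem zpow_smul_eq_zpow_smul_iff {s t : ℤ} :
    p ^ s • a = p ^ t • a ↔ s ≡ t [ZMOD MulAction.period p a] := by
  rw [Int.modEq_comm, Int.modEq_iff_dvd, ← MulAction.zpow_smul_eq_iff_period_dvd,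
    sub_eq_neg_add, zpow_add, mul_smul, zpow_neg, inv_smul_eq_iff]

theorem eq_of_pow_smul_eq_of_lt_period {i j : ℕ} (hi : i < MulAction.period p a)
    (hj : j < MulAction.period p a) (h : p ^ i • a = p ^ j • a) : i = j := by
  rw [← zpow_natCast, ← zpow_natCast, zpow_smul_eq_zpow_smul_iff, Int.natCast_modEq_iff] at h
  exact h.eq_of_lt_of_lt hi hj

theorem period_pos [Finite α] (p : G) (a : α) : 0 < MulAction.period p a :=
  Function.minimalPeriod_pos_iff_mem_periodicPts.2 ((MulAction.injective p).mem_periodicPts a)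

theorem SameOrbit.exists_lt_period [Finite α] (h : SameOrbit p a b) :
    ∃ z < MulAction.period p a, p ^ z • a = b := by
  obtain ⟨k, rfl⟩ := h
  have hpos : (0 : ℤ) < MulAction.period p a := by exact_mod_cast period_pos p a
  have h0 := Int.emod_nonneg k hpos.ne'
  have h1 := Int.emod_lt_of_pos k hpos
  refine ⟨(k % MulAction.period p a).toNat, by omega, ?_⟩
  rw [← zpow_natCast, Int.toNat_of_nonneg h0, zpow_smul_eq_zpow_smul_iff]
  exact Int.mod_modEq k _

open Classical in
theorem card_filter_sameOrbit [Fintype α] (p : G) (a : α) (P : α → Prop) :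
    #{b | SameOrbit p a b ∧ P b} = #{n ∈ range (MulAction.period p a) | P (p ^ n • a)} := by
  symm
  refine card_bij (fun n _ => p ^ n • a) ?_ ?_ ?_
  · intro n hn
    exact mem_filter.2 ⟨mem_univ _, .pow_smul p a n, (mem_filter.1 hn).2⟩
  · intro i hi j hj h
    simp only [mem_filter, mem_range] at hi hj
    exact eq_of_pow_smul_eq_of_lt_period hi.1 hj.1 h
  · intro b hb
    obtain ⟨hab, hP⟩ := (mem_filter.1 hb).2
    obtain ⟨n, hn, rfl⟩ := hab.exists_lt_period
    exact ⟨n, mem_filter.2 ⟨mem_range.2 hn, hP⟩, rfl⟩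

/-- The family `w` consists of one representative of each orbit of the cyclic group generated
by `p`. -/
structure IsTransversal (p : G) (w : ι → α) : Prop where
  eq_of_sameOrbit : ∀ ⦃i j⦄, SameOrbit p (w i) (w j) → i = j
  exists_sameOrbit : ∀ a, ∃ i, SameOrbit p (w i) a

namespace IsTransversal

theorem congr {w' : ι → α} (h : IsTransversal p w) (hw : ∀ i, SameOrbit p (w i) (w' i)) :
    IsTransversal p w' where
  eq_of_sameOrbit i j hij := h.eq_of_sameOrbit (((hw i).trans hij).trans (hw j).symm)
  exists_sameOrbit a := (h.exists_sameOrbit a).imp fun i hi => (hw i).symm.trans hi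

theorem comp {κ : Type*} (h : IsTransversal p w) (e : κ ≃ ι) : IsTransversal p (w ∘ e) where
  eq_of_sameOrbit _ _ hij := e.injective (h.eq_of_sameOrbit hij)
  exists_sameOrbit a := (h.exists_sameOrbit a).elim fun i hi => ⟨e.symm i, by simpa using hi⟩

theorem card_orbitRel_quotient (h : IsTransversal p w) :
    Nat.card (MulAction.orbitRel.Quotient (Subgroup.zpowers p) α) = Nat.card ι := by
  refine (Nat.card_eq_of_bijective (fun i => Quotient.mk'' (w i)) ⟨fun i j hij => ?_, ?_⟩).symm
  · exact h.eq_of_sameOrbit (sameOrbit_iff_orbitRel.2 (Quotient.exact' hij))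
  · intro q
    induction q using Quotient.inductionOn' with
    | h a =>
      obtain ⟨i, hi⟩ := h.exists_sameOrbit a
      exact ⟨i, Quotient.sound' (sameOrbit_iff_orbitRel.1 hi)⟩

theorem exists_of_card [Finite α] {n : ℕ}
    (hn : Nat.card (MulAction.orbitRel.Quotient (Subgroup.zpowers p) α) = n) :
    ∃ w : Fin n → α, IsTransversal p w := by
  have : Finite (MulAction.orbitRel.Quotient (Subgroup.zpowers p) α) := Quotient.finite _
  have hout : IsTransversal p
      (Quotient.out : MulAction.orbitRel.Quotient (Subgroup.zpowers p) α → α) :=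
    { eq_of_sameOrbit := fun q q' h => by
        simpa only [Quotient.out_eq] using Quotient.sound (sameOrbit_iff_orbitRel.1 h)
      exists_sameOrbit := fun a => ⟨Quotient.mk'' a, sameOrbit_iff_orbitRel.2 (Quotient.mk_out a)⟩ }
  exact ⟨_, hout.comp (Finite.equivFinOfCardEq hn).symm⟩

open Classical in
theorem sum_card_filter [Fintype α] [Fintype ι] (h : IsTransversal p w) (P : α → Prop) :
    ∑ i, #{b | SameOrbit p (w i) b ∧ P b} = #{b | P b} := by
  rw [← card_biUnion fun i _ j _ hij => disjoint_filter.2 fun b _ hi hj =>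
    hij (h.eq_of_sameOrbit (hi.1.trans hj.1.symm))]
  congr 1
  ext b
  simp only [mem_biUnion, mem_filter, mem_univ, true_and, exists_and_right]
  exact and_iff_right (h.exists_sameOrbit b)

end IsTransversal

end Orbits

namespace DartGraph

variable {Γ : DartGraph.{u, v}} {Γ' : DartGraph.{u', v'}}

theorem term_inv (x : Γ.D) : Γ.term (Γ.inv x) = Γ.beg x := by
  rw [term, Γ.inv_inv]

theorem linked_dart (x : Γ.D) : Γ.Linked (Γ.beg x) (Γ.term x) := ⟨x, rfl, rfl⟩

theorem Linked.symm {a b : Γ.V} (h : Γ.Linked a b) : Γ.Linked b a := by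
  obtain ⟨x, rfl, rfl⟩ := h
  exact ⟨Γ.inv x, rfl, term_inv x⟩

theorem IsSimple.dart_ext (h : Γ.IsSimple) {x y : Γ.D} (hb : Γ.beg x = Γ.beg y)
    (ht : Γ.term x = Γ.term y) : x = y := by
  rcases h.2.2 x y hb ht with e | rfl
  · exact e.symm
  · exact absurd hb.symm (h.2.1 x)

theorem IsSimple.not_linked_self (h : Γ.IsSimple) (a : Γ.V) : ¬ Γ.Linked a a := by
  rintro ⟨x, hb, ht⟩
  exact h.2.1 x (ht.trans hb.symm)

/-- A finite connected cubic simple graph. -/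
structure IsCubicNetwork (Γ : DartGraph.{u, v}) : Prop where
  finite : Finite Γ.V
  connected : Γ.Connected
  cubic : Γ.IsCubic
  simple : Γ.IsSimple

theorem IsCubic.card_linked (hc : Γ.IsCubic) (hs : Γ.IsSimple) (a : Γ.V) :
    Nat.card {b : Γ.V // Γ.Linked a b} = 3 := by
  rw [← hc a]
  symm
  refine Nat.card_eq_of_bijective
    (fun x : {x : Γ.D // Γ.beg x = a} => ⟨Γ.term x.1, x.1, x.2, rfl⟩) ⟨?_, ?_⟩
  · rintro ⟨x, hx⟩ ⟨y, hy⟩ h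
    exact Subtype.ext (hs.dart_ext (hx.trans hy.symm) (congrArg Subtype.val h))
  · rintro ⟨b, x, hx, rfl⟩
    exact ⟨⟨x, hx⟩, rfl⟩

theorem nonempty_iso_of_linked_iff (hs : Γ.IsSimple) (hs' : Γ'.IsSimple) (f : Γ.V ≃ Γ'.V)
    (hf : ∀ a b, Γ.Linked a b ↔ Γ'.Linked (f a) (f b)) : Nonempty (Γ.Iso Γ') := by
  have hlift : ∀ x : Γ.D, ∃ y : Γ'.D, Γ'.beg y = f (Γ.beg x) ∧ Γ'.term y = f (Γ.term x) :=
    fun x => (hf _ _).1 (linked_dart x)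
  choose F hb ht using hlift
  have hF : Function.Bijective F := by
    refine ⟨fun x y h => hs.dart_ext (f.injective ?_) (f.injective ?_), fun y => ?_⟩
    · rw [← hb, ← hb, h]
    · rw [← ht, ← ht, h]
    · obtain ⟨x, hx, hx'⟩ : Γ.Linked (f.symm (Γ'.beg y)) (f.symm (Γ'.term y)) := by
        rw [hf, f.apply_symm_apply, f.apply_symm_apply]
        exact linked_dart y
      refine ⟨x, hs'.dart_ext ?_ ?_⟩
      · rw [hb, hx, f.apply_symm_apply]
      · rw [ht, hx', f.apply_symm_apply]
  refine ⟨⟨f, Equiv.ofBijective F hF, fun x => (hb x).symm, fun x => hs'.dart_ext ?_ ?_⟩⟩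
  · exact (hb _).trans (ht x).symm
  · exact ((ht _).trans (congrArg f (term_inv x))).trans ((hb x).symm.trans (term_inv _).symm)

/-- By counting, `f` maps the three neighbours of `a` onto the three neighbours of `f a`. -/
theorem linked_of_linked_map (hs : Γ.IsSimple) (hc : Γ.IsCubic) (hs' : Γ'.IsSimple)
    (hc' : Γ'.IsCubic) {f : Γ.V → Γ'.V} (hinj : Function.Injective f)
    (hf : ∀ a b, Γ.Linked a b → Γ'.Linked (f a) (f b)) {a b : Γ.V}
    (h : Γ'.Linked (f a) (f b)) : Γ.Linked a b := by
  have hcard := (hc.card_linked hs a).trans (hc'.card_linked hs' (f a)).symm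
  have : Finite {b : Γ'.V // Γ'.Linked (f a) b} :=
    Nat.finite_of_card_ne_zero (by rw [hc'.card_linked hs' (f a)]; decide)
  let F : {b : Γ.V // Γ.Linked a b} → {b : Γ'.V // Γ'.Linked (f a) b} :=
    fun b => ⟨f b.1, hf _ _ b.2⟩
  have hF : Function.Injective F := fun b b' h =>
    Subtype.ext (hinj (congrArg Subtype.val h))
  have : Finite {b : Γ.V // Γ.Linked a b} := Finite.of_injective F hF
  obtain ⟨⟨b', hb'⟩, e⟩ := ((Nat.bijective_iff_injective_and_card F).2 ⟨hF, hcard⟩).2 ⟨f b, h⟩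
  exact hinj (congrArg Subtype.val e) ▸ hb'

theorem Aut.linked_smul_iff (p : Γ.Aut) {a b : Γ.V} :
    Γ.Linked (p • a) (p • b) ↔ Γ.Linked a b := by
  have forward : ∀ (q : Γ.Aut) {a b : Γ.V}, Γ.Linked a b → Γ.Linked (q • a) (q • b) := by
    rintro q _ _ ⟨x, rfl, rfl⟩
    refine ⟨q.1.2 x, (q.2 x).1.symm, ?_⟩
    rw [term, ← (q.2 x).2]
    exact (q.2 (Γ.inv x)).1.symm
  refine ⟨fun h => ?_, forward p⟩
  simpa only [inv_smul_smul] using forward p⁻¹ h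

namespace Iso

/-- The inverse isomorphism. -/
def symm (φ : Γ.Iso Γ') : Γ'.Iso Γ where
  onV := φ.onV.symm
  onD := φ.onD.symm
  map_beg x := by rw [Equiv.symm_apply_eq, φ.map_beg, Equiv.apply_symm_apply]
  map_inv x := by rw [Equiv.symm_apply_eq, φ.map_inv, Equiv.apply_symm_apply]

theorem map_term (φ : Γ.Iso Γ') (x : Γ.D) : φ.onV (Γ.term x) = Γ'.term (φ.onD x) := by
  rw [term, φ.map_beg, φ.map_inv, term]

theorem linked (φ : Γ.Iso Γ') {a b : Γ.V} (h : Γ.Linked a b) :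
    Γ'.Linked (φ.onV a) (φ.onV b) := by
  obtain ⟨x, rfl, rfl⟩ := h
  exact ⟨φ.onD x, (φ.map_beg x).symm, (φ.map_term x).symm⟩

theorem connected (φ : Γ.Iso Γ') (h : Γ.Connected) : Γ'.Connected := by
  intro a b
  have := (h (φ.onV.symm a) (φ.onV.symm b)).lift φ.onV fun _ _ => φ.linked
  simpa [Function.onFun] using this

theorem isCubic (φ : Γ.Iso Γ') (h : Γ.IsCubic) : Γ'.IsCubic := by
  intro a
  rw [← h (φ.onV.symm a)]
  refine (Nat.card_congr (φ.onD.subtypeEquiv fun x => ?_)).symm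
  rw [← φ.map_beg, Equiv.eq_symm_apply]

theorem isSimple (φ : Γ.Iso Γ') (h : Γ.IsSimple) : Γ'.IsSimple := by
  refine ⟨fun x hx => h.1 (φ.symm.onD x) ?_, fun x hx => h.2.1 (φ.symm.onD x) ?_,
    fun x y hb ht => .inl (φ.symm.onD.injective (h.dart_ext ?_ ?_))⟩
  · rw [← φ.symm.map_inv, hx]
  · rw [← φ.symm.map_term, ← φ.symm.map_beg, hx]
  · rw [← φ.symm.map_beg, ← φ.symm.map_beg, hb]
  · rw [← φ.symm.map_term, ← φ.symm.map_term, ht]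

theorem isCubicNetwork (φ : Γ.Iso Γ') (h : Γ.IsCubicNetwork) : Γ'.IsCubicNetwork where
  finite := have := h.finite; .of_equiv _ φ.onV
  connected := φ.connected h.connected
  cubic := φ.isCubic h.cubic
  simple := φ.isSimple h.simple

/-- Conjugation by an isomorphism. -/
def conj (φ : Γ.Iso Γ') : Γ.Aut →* Γ'.Aut where
  toFun p := ⟨(φ.onV.permCongr p.1.1, φ.onD.permCongr p.1.2), fun x => by
    obtain ⟨y, rfl⟩ := φ.onD.surjective x
    constructor
    · simp only [Equiv.permCongr_apply, Equiv.symm_apply_apply, ← φ.map_beg, (p.2 y).1]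
    · simp only [Equiv.permCongr_apply, Equiv.symm_apply_apply, ← φ.map_inv, (p.2 y).2]⟩
  map_one' := Subtype.ext (Prod.ext (map_one φ.onV.permCongrHom) (map_one φ.onD.permCongrHom))
  map_mul' p q := Subtype.ext
    (Prod.ext (map_mul φ.onV.permCongrHom p.1.1 q.1.1) (map_mul φ.onD.permCongrHom p.1.2 q.1.2))

theorem conj_smul (φ : Γ.Iso Γ') (p : Γ.Aut) (a : Γ.V) :
    φ.conj p • φ.onV a = φ.onV (p • a) :=
  congrArg (fun b => φ.onV (p.1.1 b)) (φ.onV.symm_apply_apply a)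

theorem sameOrbit_conj_iff (φ : Γ.Iso Γ') {p : Γ.Aut} {a b : Γ.V} :
    SameOrbit (φ.conj p) (φ.onV a) (φ.onV b) ↔ SameOrbit p a b := by
  simp only [SameOrbit, ← map_zpow, conj_smul, EmbeddingLike.apply_eq_iff_eq]

theorem isTransversal_conj (φ : Γ.Iso Γ') {p : Γ.Aut} {ι : Type*} {w : ι → Γ.V}
    (h : IsTransversal p w) : IsTransversal (φ.conj p) (φ.onV ∘ w) where
  eq_of_sameOrbit _ _ hij := h.eq_of_sameOrbit (φ.sameOrbit_conj_iff.1 hij)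
  exists_sameOrbit b := by
    obtain ⟨i, hi⟩ := h.exists_sameOrbit (φ.onV.symm b)
    exact ⟨i, by simpa using φ.sameOrbit_conj_iff.2 hi⟩

end Iso

end DartGraph

theorem mul_eq_lcm_of_coprime {p q a b : ℕ} (hq : 0 < q) (hpq : p.Coprime q)
    (h : p * a = q * b) : p * a = Nat.lcm a b := by
  obtain ⟨c, rfl⟩ : q ∣ a := hpq.symm.dvd_of_dvd_mul_left ⟨b, h⟩
  obtain rfl : p * c = b := Nat.eq_of_mul_eq_mul_left hq (by rw [← h]; ring)
  rw [Nat.lcm_mul_right, hpq.symm.lcm_eq_mul]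
  ring

theorem card_castHom_fibre {p n : ℕ} (hp : 0 < p) (hn : 0 < n) (i : ZMod n) :
    Nat.card {k : ZMod (p * n) // ZMod.castHom (Dvd.intro_left p rfl) (ZMod n) k = i} = p := by
  have : NeZero n := ⟨hn.ne'⟩
  have : NeZero (p * n) := ⟨(Nat.mul_pos hp hn).ne'⟩
  let f : ZMod (p * n) →+ ZMod n := (ZMod.castHom (Dvd.intro_left p rfl) (ZMod n)).toAddMonoidHom
  have hf : Function.Surjective f := ZMod.castHom_surjective (Dvd.intro_left p rfl)
  have hker : Nat.card f.ker = p := by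
    have h := AddSubgroup.card_mul_index f.ker
    rw [AddSubgroup.index_ker, f.range_eq_top.2 hf, AddSubgroup.card_top, Nat.card_zmod,
      Nat.card_zmod] at h
    exact Nat.eq_of_mul_eq_mul_right hn h
  obtain ⟨k₀, hk₀⟩ := hf i
  refine (Nat.card_congr (β := f.ker) ((Equiv.subRight k₀).subtypeEquiv fun k => ?_)).trans hker
  change f k = i ↔ f (k - k₀) = 0
  rw [map_sub, hk₀, sub_eq_zero]

namespace CyclicVoltageGraph

variable (C : CyclicVoltageGraph)

/-- The vertex `a_t` of the cover. -/
def vtx (a : C.Δ.V) (t : ℤ) : C.cover.V := ⟨a, (t : ZMod (C.iota a))⟩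

/-- The dart `x_t` of the cover. -/
def dart (x : C.Δ.D) (t : ℤ) : C.cover.D := ⟨x, (t : ZMod (C.lam x * C.iota (C.Δ.beg x)))⟩

variable {C}

theorem exists_eq_vtx (v : C.cover.V) : ∃ (a : C.Δ.V) (t : ℤ), v = C.vtx a t := by
  obtain ⟨a, k⟩ := v
  obtain ⟨t, ht⟩ := ZMod.intCast_surjective (n := C.iota a) k
  exact ⟨a, t, congrArg (Sigma.mk (β := fun a => ZMod (C.iota a)) a) ht.symm⟩

theorem exists_eq_dart (y : C.cover.D) : ∃ (x : C.Δ.D) (t : ℤ), y = C.dart x t := by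
  obtain ⟨x, k⟩ := y
  obtain ⟨t, ht⟩ := ZMod.intCast_surjective (n := C.lam x * C.iota (C.Δ.beg x)) k
  exact ⟨x, t, congrArg
    (Sigma.mk (β := fun x : C.Δ.D => ZMod (C.lam x * C.iota (C.Δ.beg x))) x) ht.symm⟩

theorem beg_dart (x : C.Δ.D) (t : ℤ) : C.cover.beg (C.dart x t) = C.vtx (C.Δ.beg x) t :=
  congrArg (Sigma.mk (β := fun a => ZMod (C.iota a)) (C.Δ.beg x))
    (map_intCast (ZMod.castHom (Dvd.intro_left _ rfl) (ZMod (C.iota (C.Δ.beg x)))) t)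

theorem inv_dart (x : C.Δ.D) (t : ℤ) :
    C.cover.inv (C.dart x t) = C.dart (C.Δ.inv x) (t + C.zeta x) := by
  refine congrArg (Sigma.mk (β := fun x : C.Δ.D => ZMod (C.lam x * C.iota (C.Δ.beg x)))
    (C.Δ.inv x)) ?_
  have h := map_intCast (ZMod.castHom (C.ratio x).symm.dvd
    (ZMod (C.lam (C.Δ.inv x) * C.iota (C.Δ.term x)))) t
  exact (congrArg (· + (C.zeta x : ZMod (C.lam (C.Δ.inv x) * C.iota (C.Δ.term x)))) h).trans
    (Int.cast_add _ _).symm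

theorem term_dart (x : C.Δ.D) (t : ℤ) :
    C.cover.term (C.dart x t) = C.vtx (C.Δ.term x) (t + C.zeta x) := by
  rw [DartGraph.term, inv_dart, beg_dart]
  rfl

theorem vtx_eq_iff {a b : C.Δ.V} {s t : ℤ} :
    C.vtx a s = C.vtx b t ↔ a = b ∧ s ≡ t [ZMOD C.iota a] := by
  constructor
  · intro h
    obtain ⟨rfl, h2⟩ := Sigma.mk.inj_iff.1 h
    exact ⟨rfl, (ZMod.intCast_eq_intCast_iff _ _ _).1 (eq_of_heq h2)⟩
  · rintro ⟨rfl, h⟩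
    exact congrArg (Sigma.mk a) ((ZMod.intCast_eq_intCast_iff _ _ _).2 h)

theorem dart_eq_of_modEq {x : C.Δ.D} {s t : ℤ}
    (h : s ≡ t [ZMOD (C.lam x * C.iota (C.Δ.beg x) : ℕ)]) : C.dart x s = C.dart x t :=
  congrArg (Sigma.mk x) ((ZMod.intCast_eq_intCast_iff _ _ _).2 h)

theorem linked_vtx (x : C.Δ.D) (t : ℤ) :
    C.cover.Linked (C.vtx (C.Δ.beg x) t) (C.vtx (C.Δ.term x) (t + C.zeta x)) :=
  ⟨C.dart x t, beg_dart x t, term_dart x t⟩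

theorem exists_dart_of_linked {v w : C.cover.V} (h : C.cover.Linked v w) :
    ∃ x t, v = C.vtx (C.Δ.beg x) t ∧ w = C.vtx (C.Δ.term x) (t + C.zeta x) := by
  obtain ⟨y, rfl, rfl⟩ := h
  obtain ⟨x, t, rfl⟩ := exists_eq_dart y
  exact ⟨x, t, beg_dart x t, term_dart x t⟩

instance : Finite C.cover.V := by
  have := C.finite_V
  have : ∀ a, NeZero (C.iota a) := fun a => ⟨(C.iota_pos a).ne'⟩
  exact inferInstanceAs (Finite (Σ a : C.Δ.V, ZMod (C.iota a)))

theorem term_ne_beg_cover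
    (hloop : ∀ x, C.Δ.term x = C.Δ.beg x → ¬ C.zeta x ≡ 0 [ZMOD C.iota (C.Δ.beg x)])
    (y : C.cover.D) : C.cover.term y ≠ C.cover.beg y := by
  intro h
  obtain ⟨x, t, rfl⟩ := exists_eq_dart y
  rw [beg_dart, term_dart, vtx_eq_iff] at h
  refine hloop x h.1 ?_
  have := h.2
  rw [h.1] at this
  exact Int.ModEq.add_left_cancel' t (by rwa [add_zero])

theorem cover_dart_ext
    (hsep : ∀ x y, C.Δ.beg x = C.Δ.beg y → C.Δ.term x = C.Δ.term y →
      C.zeta x ≡ C.zeta y [ZMOD Nat.gcd (C.iota (C.Δ.beg x)) (C.iota (C.Δ.term x))] → x = y)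
    (hco : ∀ x, (C.lam x).Coprime (C.lam (C.Δ.inv x))) {y z : C.cover.D}
    (hb : C.cover.beg y = C.cover.beg z) (ht : C.cover.term y = C.cover.term z) : y = z := by
  obtain ⟨x, s, rfl⟩ := exists_eq_dart y
  obtain ⟨x', t, rfl⟩ := exists_eq_dart z
  rw [beg_dart, beg_dart, vtx_eq_iff] at hb
  rw [term_dart, term_dart, vtx_eq_iff] at ht
  obtain ⟨hb, hst⟩ := hb
  obtain ⟨ht, hst'⟩ := ht
  obtain rfl : x = x' := by
    refine hsep x x' hb ht (Int.ModEq.add_left_cancel (hst.of_dvd ?_) (hst'.of_dvd ?_))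
    · exact_mod_cast Nat.gcd_dvd_left _ _
    · exact_mod_cast Nat.gcd_dvd_right _ _
  refine dart_eq_of_modEq (Int.modEq_iff_dvd.2 ?_)
  rw [mul_eq_lcm_of_coprime (C.lam_pos _) (hco x) (C.ratio x)]
  exact Int.natCast_dvd.2 (Nat.lcm_dvd (Int.natCast_dvd.1 hst.dvd)
    (Int.natCast_dvd.1 (Int.ModEq.add_right_cancel' _ hst').dvd))

theorem isSimple_cover
    (hloop : ∀ x, C.Δ.term x = C.Δ.beg x → ¬ C.zeta x ≡ 0 [ZMOD C.iota (C.Δ.beg x)])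
    (hsep : ∀ x y, C.Δ.beg x = C.Δ.beg y → C.Δ.term x = C.Δ.term y →
      C.zeta x ≡ C.zeta y [ZMOD Nat.gcd (C.iota (C.Δ.beg x)) (C.iota (C.Δ.term x))] → x = y)
    (hco : ∀ x, (C.lam x).Coprime (C.lam (C.Δ.inv x))) : C.cover.IsSimple :=
  ⟨fun y h => term_ne_beg_cover hloop y (by rw [DartGraph.term, h]), term_ne_beg_cover hloop,
    fun _ _ hb ht => .inl (cover_dart_ext hsep hco hb ht).symm⟩

theorem card_darts_cover [Fintype C.Δ.D] [DecidableEq C.Δ.V] (a : C.Δ.V) (i : ZMod (C.iota a)) :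
    Nat.card {y : C.cover.D // C.cover.beg y = (⟨a, i⟩ : Σ a, ZMod (C.iota a))} =
      ∑ x : C.Δ.D, if C.Δ.beg x = a then C.lam x else 0 := by
  have : ∀ x, NeZero (C.lam x * C.iota (C.Δ.beg x)) :=
    fun x => ⟨(Nat.mul_pos (C.lam_pos x) (C.iota_pos _)).ne'⟩
  let fibre (x : C.Δ.D) : Type := {k : ZMod (C.lam x * C.iota (C.Δ.beg x)) //
    (⟨C.Δ.beg x, ZMod.castHom (Dvd.intro_left _ rfl) (ZMod (C.iota (C.Δ.beg x))) k⟩ :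
      Σ a, ZMod (C.iota a)) = ⟨a, i⟩}
  have e : {y : C.cover.D // C.cover.beg y = (⟨a, i⟩ : Σ a, ZMod (C.iota a))} ≃ Σ x, fibre x :=
    { toFun := fun y => ⟨y.1.1, y.1.2, y.2⟩
      invFun := fun q => ⟨⟨q.1, q.2.1⟩, q.2.2⟩
      left_inv := fun _ => rfl
      right_inv := fun _ => rfl }
  have (x : C.Δ.D) : Finite (fibre x) := Subtype.finite
  rw [Nat.card_congr e, Nat.card_sigma]
  refine Finset.sum_congr rfl fun x _ => ?_
  split_ifs with h
  · subst h
    simp only [fibre, Sigma.mk.injEq, heq_eq_eq, true_and]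
    exact card_castHom_fibre (C.lam_pos x) (C.iota_pos _) i
  · have : IsEmpty (fibre x) := ⟨fun k => h (congrArg Sigma.fst k.2)⟩
    exact Nat.card_of_isEmpty

section Shift

variable (C)

/-- Adding one to the indices of the vertices of the cover. -/
def shiftV : Equiv.Perm C.cover.V :=
  Equiv.sigmaCongrRight fun a => Equiv.addRight (1 : ZMod (C.iota a))

/-- Adding one to the indices of the darts of the cover. -/
def shiftD : Equiv.Perm C.cover.D :=
  Equiv.sigmaCongrRight fun x => Equiv.addRight (1 : ZMod (C.lam x * C.iota (C.Δ.beg x)))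

variable {C}

theorem shiftV_vtx (a : C.Δ.V) (t : ℤ) : C.shiftV (C.vtx a t) = C.vtx a (t + 1) := by
  change (⟨a, (t : ZMod _) + 1⟩ : Σ a, ZMod (C.iota a)) = ⟨a, _⟩
  simp

theorem shiftD_dart (x : C.Δ.D) (t : ℤ) : C.shiftD (C.dart x t) = C.dart x (t + 1) := by
  change (⟨x, (t : ZMod _) + 1⟩ : Σ x, ZMod (C.lam x * C.iota (C.Δ.beg x))) = ⟨x, _⟩
  simp

variable (C) in
/-- The automorphism of the cover that adds one to all indices. -/
def shift : C.cover.Aut :=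
  ⟨(C.shiftV, C.shiftD), fun y => by
    obtain ⟨x, t, rfl⟩ := exists_eq_dart y
    constructor
    · rw [beg_dart, shiftD_dart, shiftV_vtx, beg_dart]
    · rw [inv_dart, shiftD_dart, shiftD_dart, inv_dart, add_right_comm]⟩

theorem shift_smul (a : C.Δ.V) (t : ℤ) : C.shift • C.vtx a t = C.vtx a (t + 1) :=
  shiftV_vtx a t

theorem shift_zpow_smul (a : C.Δ.V) (k t : ℤ) : C.shift ^ k • C.vtx a t = C.vtx a (t + k) := by
  induction k generalizing t with
  | zero => rw [zpow_zero, one_smul, add_zero]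
  | succ k ih => rw [zpow_add_one, mul_smul, shift_smul, ih, add_right_comm, add_assoc]
  | pred k ih =>
    obtain ⟨t, rfl⟩ : ∃ t', t = t' + 1 := ⟨t - 1, by ring⟩
    rw [zpow_sub_one, mul_smul, ← shift_smul, inv_smul_smul, ih]
    congr 1
    ring

theorem isTransversal_shift : IsTransversal C.shift fun a => C.vtx a 0 where
  eq_of_sameOrbit a b h := by
    obtain ⟨k, hk⟩ := h
    exact (vtx_eq_iff.1 ((shift_zpow_smul a k 0).symm.trans hk)).1
  exists_sameOrbit v := by
    obtain ⟨a, t, rfl⟩ := exists_eq_vtx v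
    exact ⟨a, t, by rw [shift_zpow_smul, zero_add]⟩

end Shift

section Connected

theorem eq_one_of_connected_cover {N : ℕ} (hι : ∀ a, N ∣ C.iota a)
    (hζ : ∀ x, C.zeta x ≡ 0 [ZMOD N]) (hconn : C.cover.Connected) : N = 1 := by
  let index (v : C.cover.V) : ZMod N := ZMod.castHom (hι v.1) (ZMod N) v.2
  have index_vtx (a : C.Δ.V) (t : ℤ) : index (C.vtx a t) = t := map_intCast _ t
  have index_eq {v w : C.cover.V} (h : Relation.ReflTransGen C.cover.Linked v w) :
      index v = index w := by
    induction h with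
    | refl => rfl
    | tail _ hl ih =>
      obtain ⟨x, t, rfl, rfl⟩ := exists_dart_of_linked hl
      rw [ih, index_vtx, index_vtx, Int.cast_add,
        (ZMod.intCast_eq_intCast_iff _ _ _).2 (hζ x), Int.cast_zero, add_zero]
  obtain ⟨a⟩ := C.Δ.nonempty
  have h01 := index_eq (hconn (C.vtx a 0) (C.vtx a 1))
  rw [index_vtx, index_vtx, ZMod.intCast_eq_intCast_iff_dvd_sub, sub_zero] at h01
  exact Nat.dvd_one.1 (Int.natCast_dvd_natCast.1 h01)

theorem reflTransGen_linked_symm {v w : C.cover.V}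
    (h : Relation.ReflTransGen C.cover.Linked v w) :
    Relation.ReflTransGen C.cover.Linked w v :=
  have : Std.Symm C.cover.Linked := ⟨fun _ _ => DartGraph.Linked.symm⟩
  Relation.ReflTransGen.stdSymm.symm _ _ h

variable (C) in
/-- The shifts of the index at `c` which are realised by walks of the cover. -/
def returnShifts (c : C.Δ.V) : AddSubgroup ℤ where
  carrier := {k | ∀ t, Relation.ReflTransGen C.cover.Linked (C.vtx c t) (C.vtx c (t + k))}
  zero_mem' t := by rw [add_zero]
  add_mem' {k l} hk hl t := by
    rw [← add_assoc]
    exact (hk t).trans (hl (t + k))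
  neg_mem' {k} hk t := by
    simpa only [neg_add_cancel_right] using reflTransGen_linked_symm (hk (t + -k))

variable {c : C.Δ.V}
  (hc : ∀ a t, Relation.ReflTransGen C.cover.Linked (C.vtx c t) (C.vtx a t))

include hc

theorem mem_returnShifts {a b : C.Δ.V} {k : ℤ}
    (h : ∀ t, Relation.ReflTransGen C.cover.Linked (C.vtx a t) (C.vtx b (t + k))) :
    k ∈ C.returnShifts c :=
  fun t => ((hc a t).trans (h t)).trans (reflTransGen_linked_symm (hc b _))

theorem iota_mem_returnShifts (a : C.Δ.V) : (C.iota a : ℤ) ∈ C.returnShifts c :=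
  mem_returnShifts (a := a) (b := a) hc fun t => by
    rw [show C.vtx a (t + C.iota a) = C.vtx a t from vtx_eq_iff.2 ⟨rfl, Int.add_modEq_right⟩]

theorem zeta_mem_returnShifts (x : C.Δ.D) : C.zeta x ∈ C.returnShifts c :=
  mem_returnShifts hc fun t => .single (linked_vtx x t)

theorem connected_cover_of_returnShifts_eq_top (h : C.returnShifts c = ⊤) :
    C.cover.Connected := by
  intro v w
  obtain ⟨a, s, rfl⟩ := exists_eq_vtx v
  obtain ⟨b, t, rfl⟩ := exists_eq_vtx w
  have hst : t - s ∈ C.returnShifts c := h ▸ AddSubgroup.mem_top _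
  have := hst s
  rw [add_sub_cancel] at this
  exact ((reflTransGen_linked_symm (hc a s)).trans this).trans (hc b t)

end Connected

end CyclicVoltageGraph

section Reduced

variable {z m : ℕ}

theorem not_modEq_zero_of_pos_of_lt (h0 : 0 < z) (h : z < m) : ¬ (z : ℤ) ≡ 0 [ZMOD m] := by
  intro hz
  have := Int.natCast_dvd_natCast.1 (Int.modEq_zero_iff_dvd.1 hz)
  exact absurd (Nat.le_of_dvd h0 this) (by omega)

theorem not_half_modEq_or_neg (hm : Even m) (h0 : 0 < z) (h : z < m) (h2 : 2 * z ≠ m)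
    {w : ℤ} (hw : w = z ∨ w = -z) : ¬ ((m / 2 : ℕ) : ℤ) ≡ w [ZMOD m] := by
  obtain ⟨k, rfl⟩ := hm
  rw [show (k + k) / 2 = k by omega, Int.modEq_iff_dvd]
  rintro ⟨c, hc⟩
  push_cast at hc
  have hlo : -2 < c := by by_contra; rcases hw with rfl | rfl <;> nlinarith
  have hhi : c < 2 := by by_contra; rcases hw with rfl | rfl <;> nlinarith
  interval_cases c <;> omega

theorem not_modEq_neg_self (h0 : 0 < z) (h : z < m) (h2 : 2 * z ≠ m) :
    ¬ (z : ℤ) ≡ -z [ZMOD m] := by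
  rw [Int.modEq_iff_dvd]
  rintro ⟨c, hc⟩
  have hlo : -2 < c := by by_contra; nlinarith
  have hhi : c < 0 := by by_contra; nlinarith
  interval_cases c
  omega

end Reduced

namespace DEdge

variable {n : ℕ}

/-- A link is proper if its endvertices differ and its labels are coprime; semi-edges and loops are
always proper. -/
def IsProper : DEdge n → Prop
  | semi _ => True
  | loop _ _ => True
  | link a b p q _ => a ≠ b ∧ p.Coprime q

/-- The edges lift to disjoint sets of endvertex pairs, provided that their voltages are reduced.
Parallel links have to be drawn in the same direction. -/
def Apart : DEdge n → DEdge n → Prop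
  | semi a, semi b => a ≠ b
  | loop a _, loop b _ => a ≠ b
  | link a b _ _ z, link a' b' _ _ z' => (a = a' → b = b' → z ≠ z') ∧ ¬ (a = b' ∧ b = a')
  | _, _ => True

/-- The contribution of the edge to the valence of the lifts of the vertex `c`. -/
def deg (c : Fin n) : DEdge n → ℕ
  | semi a => if a = c then 1 else 0
  | loop a _ => if a = c then 2 else 0
  | link a b p q _ => (if a = c then p else 0) + if b = c then q else 0

/-- The voltage of the dart in whose direction the edge is drawn. -/
def volt (iota : Fin n → ℕ) : DEdge n → ℕ
  | semi a => iota a / 2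
  | loop _ z => z
  | link _ _ _ _ z => z

variable {iota : Fin n → ℕ} {e e' : DEdge n} {a b a' b' : Fin n} {p q z p' q' z' : ℕ}

theorem Apart.symm (h : e.Apart e') : e'.Apart e := by
  cases e <;> cases e' <;> simp_all only [Apart, ne_eq] <;> grind

theorem IsProper.coprime_lam (h : e.IsProper) (s : e.Dir) :
    (e.lam s).Coprime (e.lam (e.inv s)) := by
  cases e with
  | semi a => exact Nat.coprime_one_left 1
  | loop a z => exact Nat.coprime_one_left 1
  | link a b p q z =>
    cases s
    exacts [h.2, h.2.symm]

theorem IsProper.beg_inv_ne (h : (link a b p q z).IsProper) (s : (link a b p q z).Dir) :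
    (link a b p q z).beg ((link a b p q z).inv s) ≠ (link a b p q z).beg s := by
  cases s
  exacts [h.1.symm, h.1]

theorem zeta_loop (iota : Fin n → ℕ) (s : (loop a z).Dir) :
    (loop a z).zeta iota s = z ∨ (loop a z).zeta iota s = -z := by
  cases s
  exacts [.inl rfl, .inr rfl]

theorem zeta_not_modEq_zero (hpos : ∀ a, 0 < iota a) (hv : e.Valid iota) (hr : e.Reduced iota)
    (hp : e.IsProper) (s : e.Dir) (h : e.beg (e.inv s) = e.beg s) :
    ¬ e.zeta iota s ≡ 0 [ZMOD iota (e.beg s)] := by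
  cases e with
  | semi a =>
    have := hpos a
    obtain ⟨k, hk⟩ := hv
    exact not_modEq_zero_of_pos_of_lt (z := iota a / 2) (m := iota a) (by omega) (by omega)
  | loop a z =>
    have hz : ¬ (z : ℤ) ≡ 0 [ZMOD iota a] := not_modEq_zero_of_pos_of_lt hr.1 hr.2.1
    rcases zeta_loop iota s with hs | hs <;> rw [hs]
    · exact hz
    · exact fun h => hz (by simpa only [beg, neg_neg, neg_zero] using h.neg)
  | link a b p q z => exact absurd h (hp.beg_inv_ne s)

theorem link_zeta_not_modEq (ha : (link a b p q z).Apart (link a' b' p' q' z'))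
    (hr : (link a b p q z).Reduced iota) (hr' : (link a' b' p' q' z').Reduced iota)
    (s : (link a b p q z).Dir) (s' : (link a' b' p' q' z').Dir)
    (hb : (link a b p q z).beg s = (link a' b' p' q' z').beg s')
    (ht : (link a b p q z).beg ((link a b p q z).inv s) =
      (link a' b' p' q' z').beg ((link a' b' p' q' z').inv s')) :
    ¬ (link a b p q z).zeta iota s ≡ (link a' b' p' q' z').zeta iota s'
      [ZMOD Nat.gcd (iota ((link a b p q z).beg s))
        (iota ((link a b p q z).beg ((link a b p q z).inv s)))] := by
  cases s <;> cases s' <;>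
    simp only [beg, inv, zeta, Bool.not_true, Bool.not_false] at hb ht ⊢
  · subst hb ht
    exact fun h => ha.1 rfl rfl (Nat.ModEq.eq_of_lt_of_lt (Int.natCast_modEq_iff.1 h) hr hr')
  · exact absurd ⟨hb, ht⟩ ha.2
  · exact absurd ⟨ht, hb⟩ ha.2
  · subst hb ht
    rw [Nat.gcd_comm]
    intro h
    exact ha.1 rfl rfl (Nat.ModEq.eq_of_lt_of_lt
      (Int.natCast_modEq_iff.1 (by simpa only [neg_neg] using h.neg)) hr hr')

theorem zeta_not_modEq (ha : e.Apart e') (hv : e.Valid iota) (hr : e.Reduced iota)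
    (hp : e.IsProper) (hv' : e'.Valid iota) (hr' : e'.Reduced iota) (hp' : e'.IsProper)
    (s : e.Dir) (s' : e'.Dir) (hb : e.beg s = e'.beg s')
    (ht : e.beg (e.inv s) = e'.beg (e'.inv s')) :
    ¬ e.zeta iota s ≡ e'.zeta iota s'
      [ZMOD Nat.gcd (iota (e.beg s)) (iota (e.beg (e.inv s)))] := by
  cases e with
  | semi a =>
    cases e' with
    | semi a' => exact absurd hb ha
    | loop a' z =>
      obtain rfl : a = a' := hb
      simp only [beg, Nat.gcd_self]
      exact not_half_modEq_or_neg hv hr'.1 hr'.2.1 hr'.2.2 (zeta_loop iota s')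
    | link a' b' p q z => exact absurd (ht.symm.trans hb) (hp'.beg_inv_ne s')
  | loop a z =>
    cases e' with
    | semi a' =>
      obtain rfl : a = a' := hb
      simp only [beg, Nat.gcd_self]
      exact fun h => not_half_modEq_or_neg hv' hr.1 hr.2.1 hr.2.2 (zeta_loop iota s) h.symm
    | loop a' z' => exact absurd hb ha
    | link a' b' p q z' => exact absurd (ht.symm.trans hb) (hp'.beg_inv_ne s')
  | link a b p q z =>
    cases e' with
    | semi a' => exact absurd (ht.trans hb.symm) (hp.beg_inv_ne s)
    | loop a' z' => exact absurd (ht.trans hb.symm) (hp.beg_inv_ne s)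
    | link a' b' p' q' z' => exact link_zeta_not_modEq ha hr hr' s s' hb ht

theorem dir_eq_of_zeta_modEq (hr : e.Reduced iota) (hp : e.IsProper) {s s' : e.Dir}
    (hb : e.beg s = e.beg s')
    (hz : e.zeta iota s ≡ e.zeta iota s'
      [ZMOD Nat.gcd (iota (e.beg s)) (iota (e.beg (e.inv s)))]) : s = s' := by
  cases e with
  | semi a => rfl
  | loop a z =>
    have hne := not_modEq_neg_self hr.1 hr.2.1 hr.2.2
    simp only [beg, Nat.gcd_self] at hz
    cases s <;> cases s'
    exacts [rfl, absurd hz hne, absurd hz.symm hne, rfl]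
  | link a b p q z =>
    cases s <;> cases s'
    exacts [rfl, absurd hb hp.1, absurd hb.symm hp.1, rfl]

theorem sum_lam_eq_deg [inst : Fintype e.Dir] (c : Fin n) :
    (∑ s : e.Dir, if e.beg s = c then e.lam s else 0) = e.deg c := by
  cases e with
  | semi b =>
    obtain rfl : inst = inferInstanceAs (Fintype Unit) := Subsingleton.elim _ _
    exact Fintype.sum_unique (ι := Unit) _
  | loop b z =>
    obtain rfl : inst = inferInstanceAs (Fintype Bool) := Subsingleton.elim _ _
    refine (Fintype.sum_bool (fun s : Bool => if beg (.loop b z) s = c then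
      lam (.loop b z) s else 0)).trans ?_
    change (if b = c then 1 else 0) + (if b = c then 1 else 0) = if b = c then 2 else 0
    split_ifs <;> rfl
  | link b b' p q z =>
    obtain rfl : inst = inferInstanceAs (Fintype Bool) := Subsingleton.elim _ _
    refine (Fintype.sum_bool (fun s : Bool => if beg (.link b b' p q z) s = c then
      lam (.link b b' p q z) s else 0)).trans ?_
    exact add_comm (if b' = c then q else 0) (if b = c then p else 0)

theorem zeta_modEq_zero {N : ℕ} (he : N ∣ e.volt iota) (s : e.Dir) :
    e.zeta iota s ≡ 0 [ZMOD N] := by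
  have hN : (N : ℤ) ∣ e.volt iota := Int.natCast_dvd_natCast.2 he
  refine Int.modEq_zero_iff_dvd.2 ?_
  cases e with
  | semi a => exact hN
  | loop a z =>
    cases s
    exacts [hN, hN.neg_right]
  | link a b p q z =>
    cases s
    exacts [hN, hN.neg_right]

theorem exists_zeta_eq_volt (iota : Fin n → ℕ) (e : DEdge n) :
    ∃ s : e.Dir, e.zeta iota s = e.volt iota := by
  cases e with
  | semi a => exact ⟨(), rfl⟩
  | loop a z => exact ⟨false, rfl⟩
  | link a b p q z => exact ⟨false, rfl⟩

theorem exists_zeta_eq_zero {c : Fin n} (hj : e.joins c a) (hz : e.volt iota = 0) :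
    ∃ s : e.Dir, e.beg s = c ∧ e.beg (e.inv s) = a ∧ e.zeta iota s = 0 := by
  cases e with
  | semi _ => exact hj.elim
  | loop _ _ => exact hj.elim
  | link a' b' p q z =>
    obtain rfl : z = 0 := hz
    rcases hj with ⟨rfl, rfl⟩ | ⟨rfl, rfl⟩
    exacts [⟨false, rfl, rfl, rfl⟩, ⟨true, rfl, rfl, rfl⟩]

end DEdge

namespace Diagram

/-- The local conditions under which the cyclic generalised cover of a diagram is cubic and
simple. -/
structure IsGood (d : Diagram) : Prop where
  iota_pos : ∀ a, 0 < d.iota a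
  edges_valid : ∀ e ∈ d.edges, e.Valid d.iota
  reduced : ∀ e ∈ d.edges, e.Reduced d.iota
  proper : ∀ e ∈ d.edges, e.IsProper
  apart : d.edges.Pairwise DEdge.Apart
  degree : ∀ a, (d.edges.map (DEdge.deg a)).sum = 3
  star : ∃ c, ∀ a, a = c ∨ ∃ e ∈ d.edges, e.joins c a ∧ e.volt d.iota = 0

/-- `N` divides all indices and all voltages; the cover is connected if and only if this forces
`N = 1`. -/
structure CommonDivisor (d : Diagram) (N : ℕ) : Prop where
  dvd_iota : ∀ a, N ∣ d.iota a
  dvd_volt : ∀ e ∈ d.edges, N ∣ e.volt d.iota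

variable {d : Diagram}

theorem IsGood.valid (h : d.IsGood) : d.Valid where
  iota_pos := h.iota_pos
  edges_valid := h.edges_valid
  centre := h.star.imp fun _ hc a => (hc a).imp_right fun ⟨e, he, hj, _⟩ => ⟨e, he, hj⟩

theorem IsGood.isSimple (h : d.IsGood) : (d.voltageGraph h.valid).cover.IsSimple := by
  refine CyclicVoltageGraph.isSimple_cover ?_ ?_ ?_
  · rintro ⟨k, s⟩ ht
    have hk := d.edges.get_mem k
    exact DEdge.zeta_not_modEq_zero h.iota_pos (h.edges_valid _ hk) (h.reduced _ hk)
      (h.proper _ hk) s ht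
  · rintro ⟨k, s⟩ ⟨k', s'⟩ hb ht hz
    have hk := d.edges.get_mem k
    have hk' := d.edges.get_mem k'
    by_cases hkk' : k = k'
    · subst hkk'
      exact congrArg (Sigma.mk (β := fun k => (d.edges.get k).Dir) k)
        (DEdge.dir_eq_of_zeta_modEq (h.reduced _ hk) (h.proper _ hk) hb hz)
    · have hapart : (d.edges.get k).Apart (d.edges.get k') :=
        (lt_or_gt_of_ne hkk').elim (List.pairwise_iff_get.1 h.apart _ _)
          fun hlt => (List.pairwise_iff_get.1 h.apart _ _ hlt).symm
      exact absurd hz (DEdge.zeta_not_modEq hapart (h.edges_valid _ hk) (h.reduced _ hk)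
        (h.proper _ hk) (h.edges_valid _ hk') (h.reduced _ hk') (h.proper _ hk') s s' hb ht)
  · rintro ⟨k, s⟩
    exact (h.proper _ (d.edges.get_mem k)).coprime_lam s

theorem sum_lam_eq_sum_deg (h : Nonempty (Fin d.n)) (a : Fin d.n)
    [inst : Fintype (d.graph h).D] :
    (∑ x : (d.graph h).D, if (d.edges.get x.1).beg x.2 = a then (d.edges.get x.1).lam x.2 else 0)
      = (d.edges.map (DEdge.deg a)).sum := by
  have : ∀ k : Fin d.edges.length, Fintype (d.edges.get k).Dir := fun k => Fintype.ofFinite _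
  obtain rfl : inst = inferInstanceAs (Fintype (Σ k : Fin d.edges.length, (d.edges.get k).Dir)) :=
    Subsingleton.elim _ _
  refine (Fintype.sum_sigma (fun x : (Σ k : Fin d.edges.length, (d.edges.get k).Dir) =>
    if (d.edges.get x.1).beg x.2 = a then (d.edges.get x.1).lam x.2 else 0)).trans ?_
  simp_rw [DEdge.sum_lam_eq_deg]
  rw [← List.sum_ofFn]
  congr 1
  apply List.ext_get <;> simp

theorem IsGood.isCubic (h : d.IsGood) : (d.voltageGraph h.valid).cover.IsCubic := by
  rintro ⟨a, i⟩
  let : DecidableEq (d.voltageGraph h.valid).Δ.V := inferInstanceAs (DecidableEq (Fin d.n))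
  have : Fintype (d.voltageGraph h.valid).Δ.D :=
    @Fintype.ofFinite _ (d.voltageGraph h.valid).finite_D
  refine (CyclicVoltageGraph.card_darts_cover a i).trans ?_
  exact (sum_lam_eq_sum_deg h.valid.nonempty a (inst := this)).trans (h.degree a)

theorem IsGood.eq_one_of_connected (h : d.IsGood) {N : ℕ} (hN : d.CommonDivisor N)
    (hconn : (d.voltageGraph h.valid).cover.Connected) : N = 1 :=
  CyclicVoltageGraph.eq_one_of_connected_cover (C := d.voltageGraph h.valid) hN.dvd_iota
    (fun x => DEdge.zeta_modEq_zero (hN.dvd_volt _ (d.edges.get_mem x.1)) x.2) hconn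

theorem IsGood.exists_spanning_star (h : d.IsGood) : ∃ c : Fin d.n, ∀ (a : Fin d.n) (t : ℤ),
    Relation.ReflTransGen (d.voltageGraph h.valid).cover.Linked
      ((d.voltageGraph h.valid).vtx c t) ((d.voltageGraph h.valid).vtx a t) := by
  obtain ⟨c, hc⟩ := h.star
  refine ⟨c, fun a t => ?_⟩
  rcases hc a with rfl | ⟨e, he, hj, hz⟩
  · exact .refl
  · obtain ⟨k, rfl⟩ := List.get_of_mem he
    obtain ⟨s, rfl, rfl, hs⟩ := DEdge.exists_zeta_eq_zero hj hz
    have := CyclicVoltageGraph.linked_vtx (C := d.voltageGraph h.valid) ⟨k, s⟩ t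
    rw [show (d.voltageGraph h.valid).zeta ⟨k, s⟩ = 0 from hs, add_zero] at this
    exact .single this

theorem IsGood.connected (h : d.IsGood) (hN : ∀ N, d.CommonDivisor N → N = 1) :
    (d.voltageGraph h.valid).cover.Connected := by
  obtain ⟨c, hc⟩ := h.exists_spanning_star
  refine CyclicVoltageGraph.connected_cover_of_returnShifts_eq_top hc ?_
  obtain ⟨g, hg⟩ := Int.subgroup_cyclic ((d.voltageGraph h.valid).returnShifts c)
  rw [← AddSubgroup.zmultiples_eq_closure] at hg
  have dvd_of_mem {z : ℕ} (hz : (z : ℤ) ∈ (d.voltageGraph h.valid).returnShifts c) :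
      g.natAbs ∣ z := by
    rwa [hg, Int.mem_zmultiples_iff, ← Int.natAbs_dvd, Int.natCast_dvd_natCast] at hz
  have hg1 : g.natAbs = 1 := by
    refine hN _ ⟨fun a => dvd_of_mem (CyclicVoltageGraph.iota_mem_returnShifts
      (C := d.voltageGraph h.valid) hc a), fun e he => ?_⟩
    obtain ⟨k, rfl⟩ := List.get_of_mem he
    obtain ⟨s, hs⟩ := DEdge.exists_zeta_eq_volt d.iota (d.edges.get k)
    exact dvd_of_mem (hs ▸ CyclicVoltageGraph.zeta_mem_returnShifts
      (C := d.voltageGraph h.valid) hc ⟨k, s⟩)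
  refine eq_top_iff.2 fun k _ => ?_
  rw [hg, Int.mem_zmultiples_iff, ← Int.natAbs_dvd, hg1, Nat.cast_one]
  exact one_dvd k

end Diagram

namespace DEdge

variable {n : ℕ} {iota : Fin n → ℕ} {a b c : Fin n} {p q z z' : ℕ}

@[simp]
theorem valid_semi : Valid iota (.semi a) ↔ iota a % 2 = 0 := Nat.even_iff

@[simp]
theorem valid_loop : Valid iota (.loop a z) := trivial

@[simp]
theorem valid_link : Valid iota (.link a b p q z) ↔ 0 < p ∧ 0 < q ∧ p * iota a = q * iota b :=
  Iff.rfl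

@[simp]
theorem reduced_semi : Reduced iota (.semi a) := trivial

@[simp]
theorem reduced_loop : Reduced iota (.loop a z) ↔ 0 < z ∧ z < iota a ∧ 2 * z ≠ iota a := Iff.rfl

@[simp]
theorem isProper_semi : (semi a).IsProper := trivial

@[simp]
theorem isProper_loop : (loop a z).IsProper := trivial

@[simp]
theorem isProper_link : (link a b p q z).IsProper ↔ a ≠ b ∧ p.Coprime q := Iff.rfl

@[simp]
theorem apart_semi_semi : (semi a).Apart (semi b) ↔ a ≠ b := Iff.rfl

@[simp]
theorem apart_semi_loop : (semi a).Apart (loop b z) := trivial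

@[simp]
theorem apart_loop_semi : (loop b z).Apart (semi a) := trivial

@[simp]
theorem apart_loop_loop : (loop a z).Apart (loop b z') ↔ a ≠ b := Iff.rfl

@[simp]
theorem apart_link_semi : (link a b p q z).Apart (semi c) := trivial

@[simp]
theorem apart_link_loop : (link a b p q z).Apart (loop c z') := trivial

@[simp]
theorem apart_link_link {a' b' : Fin n} {p' q' : ℕ} :
    (link a b p q z).Apart (link a' b' p' q' z') ↔
      (a = a' → b = b' → z ≠ z') ∧ ¬ (a = b' ∧ b = a') :=
  Iff.rfl

@[simp]
theorem reduced_link : Reduced iota (.link a b p q z) ↔ z < Nat.gcd (iota a) (iota b) := Iff.rfl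

end DEdge

theorem Diagram.commonDivisor_iff {d : Diagram} {N : ℕ} :
    d.CommonDivisor N ↔ (∀ a, N ∣ d.iota a) ∧ ∀ e ∈ d.edges, N ∣ e.volt d.iota :=
  ⟨fun h => ⟨h.1, h.2⟩, fun h => ⟨h.1, h.2⟩⟩

/-- The conditions on the parameters of the `i`-th diagram under which its cover is cubic and
simple, but possibly disconnected. -/
def LocalConditions (i m r s : ℕ) : Prop :=
  match i with
  | 7 | 9 | 10 => 4 ∣ m
  | 11 => 8 ∣ m
  | 15 => 6 ∣ m
  | 16 | 2 | 6 | 8 | 17 | 19 => True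
  | 1 | 5 | 12 | 13 | 14 | 18 | 24 | 25 => Even m
  | 3 | 20 | 21 | 22 => Even m ∧ r ≠ 0
  | 4 => 0 < r ∧ r < s
  | 23 => Even m ∧ r ≠ s
  | _ => False

/-- The parameters give a cubic simple cover. -/
structure LocallyAdmissible (i m r s : ℕ) : Prop where
  pos : 0 < m
  conditions : LocalConditions i m r s
  reduced : (diagram i m r s).Reduced

/-- The greatest common divisor of the indices and voltages of the `i`-th diagram, when its
parameters satisfy `LocalConditions`. -/
def content (i m r s : ℕ) : ℕ :=
  match i with
  | 7 | 9 | 10 => m / 4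
  | 11 => m / 8
  | 15 => m / 6
  | 1 | 3 | 5 | 12 | 13 | 14 | 18 | 20 | 21 | 24 => Nat.gcd (m / 2) r
  | 6 | 8 | 19 => Nat.gcd m r
  | 2 | 4 | 17 => Nat.gcd m (Nat.gcd r s)
  | 22 | 23 | 25 => Nat.gcd (m / 2) (Nat.gcd r s)
  | _ => m

theorem LocallyAdmissible.isGood {i m r s : ℕ} (h : LocallyAdmissible i m r s) :
    (diagram i m r s).IsGood := by
  obtain ⟨hm, hc, hr⟩ := h
  unfold LocalConditions at hc
  split at hc <;> try exact hc.elim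
  all_goals
    try simp only [Nat.even_iff] at hc
    change Diagram.Reduced ⟨_, _, _⟩ at hr
    change Diagram.IsGood ⟨_, _, _⟩
    constructor
    case reduced => exact hr
    case iota_pos => simp [Fin.forall_fin_succ]; omega
    case edges_valid => simp <;> omega
    case proper => simp [Nat.odd_iff]
    case apart => simp <;> omega
    case degree => intro a; fin_cases a <;> rfl
    case star => simp [DEdge.joins, DEdge.volt, Fin.forall_fin_succ]

theorem dvd_of_dvd_mul_of_coprime {k l N u : ℕ} (h : k.Coprime l) (hk : N ∣ k * u)
    (hl : N ∣ l * u) : N ∣ u := by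
  simpa only [Nat.gcd_mul_right, h.gcd_eq_one, one_mul] using Nat.dvd_gcd hk hl

theorem LocallyAdmissible.commonDivisor_iff {i m r s N : ℕ} (h : LocallyAdmissible i m r s) :
    (diagram i m r s).CommonDivisor N ↔ N ∣ content i m r s := by
  obtain ⟨-, hc, -⟩ := h
  unfold LocalConditions at hc
  split at hc <;> try exact hc.elim
  all_goals
    change Diagram.CommonDivisor ⟨_, _, _⟩ N ↔ N ∣ _
    simp only [Diagram.commonDivisor_iff, Fin.forall_fin_succ, IsEmpty.forall_iff,
      List.forall_mem_cons, List.not_mem_nil, DEdge.volt, content, Nat.dvd_gcd_iff, Matrix.cons_val,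
      Fin.succ_zero_eq_one, Fin.succ_one_eq_two, dvd_zero]
  case h_1 | h_2 | h_3 =>
    obtain ⟨u, rfl⟩ := hc
    have := dvd_of_dvd_mul_of_coprime (k := 4) (l := 3) (N := N) (u := u) (by decide)
    simp only [show 3 * (4 * u) / 2 = 6 * u by omega, show 6 * u / 2 = 3 * u by omega,
      show 4 * u / 2 = 2 * u by omega, show 2 * u / 2 = u by omega, show 4 * u / 4 = u by omega]
    exact ⟨by tauto, fun h => by simp [h, Dvd.dvd.mul_left]⟩
  case h_4 =>
    obtain ⟨u, rfl⟩ := hc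
    have := dvd_of_dvd_mul_of_coprime (k := 8) (l := 3) (N := N) (u := u) (by decide)
    simp only [show 3 * (8 * u) / 2 = 12 * u by omega, show 3 * (8 * u) / 4 = 6 * u by omega,
      show 6 * u / 2 = 3 * u by omega, show 8 * u / 8 = u by omega]
    exact ⟨by tauto, fun h => by simp [h, Dvd.dvd.mul_left]⟩
  case h_5 =>
    obtain ⟨u, rfl⟩ := hc
    have := dvd_of_dvd_mul_of_coprime (k := 2) (l := 3) (N := N) (u := u) (by decide)
    simp only [show 6 * u / 3 = 2 * u by omega, show 6 * u / 2 = 3 * u by omega,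
      show 6 * u / 6 = u by omega]
    exact ⟨by tauto, fun h => by simp [h, Dvd.dvd.mul_left]⟩
  case h_6 | h_7 | h_8 | h_9 | h_10 | h_11 | h_24 =>
    exact ⟨by tauto, fun h => by simp [h, Dvd.dvd.mul_left]⟩
  all_goals
    obtain ⟨u, hu⟩ : Even m := by tauto
    obtain rfl : m = 2 * u := by omega
    have := dvd_of_dvd_mul_of_coprime (k := 2) (l := 3) (N := N) (u := u) (by decide)
    simp only [show 3 * (2 * u) / 2 = 3 * u by omega, show 2 * u / 2 = u by omega,
      show 2 * (2 * u) / 2 = 2 * u by omega]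
    exact ⟨by tauto, fun h => by simp [h, Dvd.dvd.mul_left]⟩


theorem admissible_iff {i m r s : ℕ} :
    Admissible i m r s ↔ LocallyAdmissible i m r s ∧ content i m r s = 1 := by
  suffices 0 < m → (diagram i m r s).Reduced →
      (ParameterConditions i m r s ↔ LocalConditions i m r s ∧ content i m r s = 1) from
    ⟨fun ⟨hm, hc, hr⟩ => ⟨⟨hm, ((this hm hr).1 hc).1, hr⟩, ((this hm hr).1 hc).2⟩,
      fun ⟨⟨hm, hc, hr⟩, h1⟩ => ⟨hm, (this hm hr).2 ⟨hc, h1⟩, hr⟩⟩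
  intro _ hr
  unfold ParameterConditions
  split
  all_goals
    change Diagram.Reduced ⟨_, _, _⟩ at hr
    simp only [Diagram.Reduced, List.forall_mem_cons, List.not_mem_nil, DEdge.reduced_semi,
      DEdge.reduced_loop, DEdge.reduced_link, Matrix.cons_val, Nat.gcd_self] at hr
  case h_6 | h_23 => simp only [LocalConditions, content, true_and]
  all_goals
    simp only [LocalConditions, content, Nat.even_iff]
    grind

theorem Admissible.locallyAdmissible {i m r s : ℕ} (h : Admissible i m r s) :
    LocallyAdmissible i m r s :=
  (admissible_iff.1 h).1

theorem Admissible.isCubicNetwork_gammaGraph {i m r s : ℕ} (h : Admissible i m r s) :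
    (gammaGraph i m r s h).IsCubicNetwork := by
  have hgood := h.locallyAdmissible.isGood
  refine ⟨inferInstanceAs (Finite (CyclicVoltageGraph.cover _).V), hgood.connected fun N hN => ?_,
    hgood.isCubic, hgood.isSimple⟩
  rw [h.locallyAdmissible.commonDivisor_iff, (admissible_iff.1 h).2] at hN
  exact Nat.dvd_one.1 hN

theorem diagram_n_le (i m r s : ℕ) : (diagram i m r s).n ≤ 3 := by
  unfold diagram
  split <;> simp only [le_refl, Nat.reduceLeDiff, zero_le]

namespace DartGraph

variable {Γ : DartGraph.{u, v}}

theorem exists_isCyclic_of_iso {i m r s : ℕ} {h : Admissible i m r s}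
    (φ : (gammaGraph i m r s h).Iso Γ) :
    ∃ G : Subgroup Γ.Aut, IsCyclic G ∧ Nat.card (MulAction.orbitRel.Quotient G Γ.V) ≤ 3 := by
  refine ⟨Subgroup.zpowers (φ.conj (CyclicVoltageGraph.shift _)), inferInstance, ?_⟩
  rw [(φ.isTransversal_conj CyclicVoltageGraph.isTransversal_shift).card_orbitRel_quotient]
  exact (Nat.card_fin _).trans_le (diagram_n_le i m r s)

end DartGraph

namespace CyclicVoltageGraph

variable {C : CyclicVoltageGraph} {G α : Type*} [Group G] [MulAction G α] {p : G}
  {w : C.Δ.V → α}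

/-- The map from the vertices of the cover to a set with an action, sending `a_t` to `p ^ t • w a`.
It is well defined when the orbit of `w a` under `p` has length `ι(a)`. -/
def orbitMap (p : G) (w : C.Δ.V → α) (v : C.cover.V) : α :=
  p ^ (ZMod.cast v.2 : ℤ) • w v.1

theorem orbitMap_vtx (hper : ∀ a, MulAction.period p (w a) = C.iota a) (a : C.Δ.V) (t : ℤ) :
    orbitMap p w (C.vtx a t) = p ^ t • w a := by
  refine zpow_smul_eq_zpow_smul_iff.2 ?_
  rw [hper, ← ZMod.intCast_eq_intCast_iff]
  exact ZMod.intCast_zmod_cast _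

theorem orbitMap_bijective (hw : IsTransversal p w)
    (hper : ∀ a, MulAction.period p (w a) = C.iota a) : Function.Bijective (orbitMap p w) := by
  constructor
  · intro v v' h
    obtain ⟨a, s, rfl⟩ := exists_eq_vtx v
    obtain ⟨b, t, rfl⟩ := exists_eq_vtx v'
    rw [orbitMap_vtx hper, orbitMap_vtx hper] at h
    obtain rfl : a = b := hw.eq_of_sameOrbit
      ((SameOrbit.zpow_smul p (w a) s).trans (h ▸ (SameOrbit.zpow_smul p (w b) t).symm))
    exact vtx_eq_iff.2 ⟨rfl, hper a ▸ zpow_smul_eq_zpow_smul_iff.1 h⟩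
  · intro v
    obtain ⟨a, k, rfl⟩ := hw.exists_sameOrbit v
    exact ⟨C.vtx a k, orbitMap_vtx hper a k⟩

end CyclicVoltageGraph

namespace DartGraph

variable {Γ : DartGraph.{u, v}} {p : Γ.Aut} {n : ℕ} {w : Fin n → Γ.V}

theorem linked_zpow_smul_iff {a b : Γ.V} (k : ℤ) :
    Γ.Linked (p ^ k • a) (p ^ k • b) ↔ Γ.Linked a b :=
  Aut.linked_smul_iff (p ^ k)

/-- The edge of a diagram is present in `Γ` when `w a` plays the role of the vertex `a_0` of the
cover and `p` acts as the shift of the indices. -/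
def Realises (p : Γ.Aut) (w : Fin n → Γ.V) : DEdge n → Prop
  | .semi a => Γ.Linked (w a) (p ^ (MulAction.period p (w a) / 2) • w a)
  | .loop a z => Γ.Linked (w a) (p ^ z • w a)
  | .link a b _ _ z => Γ.Linked (w a) (p ^ z • w b)

theorem Realises.linked {e : DEdge n} (h : Realises p w e) (s : e.Dir) (t : ℤ) :
    Γ.Linked (p ^ t • w (e.beg s))
      (p ^ (t + e.zeta (fun a => MulAction.period p (w a)) s) • w (e.beg (e.inv s))) := by
  have forward {a b : Γ.V} {z : ℕ} (h : Γ.Linked a (p ^ z • b)) :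
      Γ.Linked (p ^ t • a) (p ^ (t + (z : ℤ)) • b) := by
    rwa [zpow_add, mul_smul, linked_zpow_smul_iff, zpow_natCast]
  have backward {a b : Γ.V} {z : ℕ} (h : Γ.Linked a (p ^ z • b)) :
      Γ.Linked (p ^ t • b) (p ^ (t + -(z : ℤ)) • a) := by
    rw [← linked_zpow_smul_iff (p := p) (t + -(z : ℤ)), smul_smul, ← zpow_natCast, ← zpow_add,
      neg_add_cancel_right] at h
    exact h.symm
  cases e with
  | semi a => exact forward h
  | loop a z => cases s with
    | false => exact forward h
    | true => exact backward h
  | link a b _ _ z => cases s with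
    | false => exact forward h
    | true => exact backward h

theorem nonempty_iso_cover (hΓ : Γ.IsCubicNetwork) {d : Diagram} (hd : d.IsGood)
    {w : Fin d.n → Γ.V} (hw : IsTransversal p w)
    (hper : ∀ a, MulAction.period p (w a) = d.iota a) (hedge : ∀ e ∈ d.edges, Realises p w e) :
    Nonempty (Γ.Iso (d.voltageGraph hd.valid).cover) := by
  let F := CyclicVoltageGraph.orbitMap (C := d.voltageGraph hd.valid) p w
  have hF (a : Fin d.n) (t : ℤ) : F ((d.voltageGraph hd.valid).vtx a t) = p ^ t • w a :=
    CyclicVoltageGraph.orbitMap_vtx (C := d.voltageGraph hd.valid) hper a t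
  have hbij : Function.Bijective F := CyclicVoltageGraph.orbitMap_bijective hw hper
  have hlinked : ∀ v v', (d.voltageGraph hd.valid).cover.Linked v v' → Γ.Linked (F v) (F v') := by
    intro v v' h
    obtain ⟨⟨k, s⟩, t, rfl, rfl⟩ := CyclicVoltageGraph.exists_dart_of_linked h
    have := (hedge _ (d.edges.get_mem k)).linked s t
    rw [funext hper] at this
    rwa [← hF, ← hF] at this
  obtain ⟨φ⟩ := nonempty_iso_of_linked_iff hd.isSimple hΓ.simple (.ofBijective F hbij) fun v v' =>
    ⟨hlinked v v', linked_of_linked_map hd.isSimple hd.isCubic hΓ.simple hΓ.cubic hbij.1 hlinked⟩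
  exact ⟨φ.symm⟩

/-- The graph is isomorphic to one of the listed graphs `Γ_i(m; r, s)`. -/
def IsListed (Γ : DartGraph.{u, v}) : Prop :=
  ∃ i m r s : ℕ, ∃ h : Admissible i m r s, Nonempty (Γ.Iso (gammaGraph i m r s h))

theorem isListed_of_realises (hΓ : Γ.IsCubicNetwork) (i m r s : ℕ) {d : Diagram}
    (hd : diagram i m r s = d) (hm : 0 < m) (hc : LocalConditions i m r s) {w : Fin d.n → Γ.V}
    (hw : IsTransversal p w) (hedge : d.edges.Forall (Realises p w))
    (hper : ∀ a, MulAction.period p (w a) = d.iota a := by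
      simp [Fin.forall_fin_succ] <;> omega)
    (hred : d.edges.Forall (DEdge.Reduced d.iota) := by simp [DEdge.Reduced] <;> omega) :
    Γ.IsListed := by
  subst hd
  have hadm : LocallyAdmissible i m r s := ⟨hm, hc, List.forall_iff_forall_mem.1 hred⟩
  obtain ⟨φ⟩ := nonempty_iso_cover hΓ hadm.isGood hw hper
    (List.forall_iff_forall_mem.1 hedge)
  have hcontent : content i m r s = 1 :=
    hadm.isGood.eq_one_of_connected (hadm.commonDivisor_iff.2 dvd_rfl) (φ.connected hΓ.connected)
  exact ⟨i, m, r, s, admissible_iff.2 ⟨hadm, hcontent⟩, ⟨φ⟩⟩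

end DartGraph

namespace DartGraph

open Finset

variable {Γ : DartGraph.{u, v}} {p : Γ.Aut} {a a' b b' : Γ.V}

open Classical in
/-- The exponents `z`, reduced modulo the length of the orbit of `b`, such that `a` is adjacent
to `p ^ z • b`: the voltages of the edges from `a` to the orbit of `b`. -/
noncomputable def residues (p : Γ.Aut) (a b : Γ.V) : Finset ℕ :=
  (range (MulAction.period p b)).filter fun z => Γ.Linked a (p ^ z • b)

theorem mem_residues {z : ℕ} :
    z ∈ residues p a b ↔ z < MulAction.period p b ∧ Γ.Linked a (p ^ z • b) := by
  simp only [residues, mem_filter, mem_range]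

/-- The number of neighbours of `a` in the orbit of `b`, which is the label of the darts from the
orbit of `a` to the orbit of `b` when these are parallel. -/
noncomputable def orbitDegree (p : Γ.Aut) (a b : Γ.V) : ℕ := #(residues p a b)

open Classical in
theorem orbitDegree_eq_card_filter [Fintype Γ.V] (p : Γ.Aut) (a b : Γ.V) :
    orbitDegree p a b = #{v | SameOrbit p b v ∧ Γ.Linked a v} :=
  (card_filter_sameOrbit p b _).symm

theorem sum_orbitDegree [Finite Γ.V] {ι : Type*} [Fintype ι] {w : ι → Γ.V} (hc : Γ.IsCubic)
    (hs : Γ.IsSimple) (hw : IsTransversal p w) (a : Γ.V) : ∑ i, orbitDegree p a (w i) = 3 := by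
  classical
  have := Fintype.ofFinite Γ.V
  simp only [orbitDegree_eq_card_filter]
  rw [hw.sum_card_filter, ← hc.card_linked hs a, Nat.card_eq_fintype_card, Fintype.card_subtype]

theorem orbitDegree_congr [Finite Γ.V] (ha : SameOrbit p a a') (hb : SameOrbit p b b') :
    orbitDegree p a b = orbitDegree p a' b' := by
  classical
  have := Fintype.ofFinite Γ.V
  obtain ⟨k, rfl⟩ := ha
  rw [orbitDegree_eq_card_filter, orbitDegree_eq_card_filter]
  refine card_equiv (MulAction.toPerm (p ^ k)) fun v => ?_
  simp only [mem_filter, mem_univ, true_and, MulAction.toPerm_apply, linked_zpow_smul_iff]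
  refine and_congr_left fun _ => ⟨fun h => ?_, fun h => ?_⟩
  · exact hb.symm.trans (h.trans (.zpow_smul p v k))
  · exact hb.trans (h.trans (SameOrbit.zpow_smul p v k).symm)

theorem orbitDegree_mul_period [Finite Γ.V] (p : Γ.Aut) (a b : Γ.V) :
    orbitDegree p a b * MulAction.period p a = orbitDegree p b a * MulAction.period p b := by
  classical
  have := Fintype.ofFinite Γ.V
  have card_orbit (c : Γ.V) : #{v | SameOrbit p c v} = MulAction.period p c := by
    simpa using card_filter_sameOrbit p c fun _ => True
  rw [← card_orbit a, ← card_orbit b, mul_comm, mul_comm (orbitDegree p b a)]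
  refine card_mul_eq_card_mul Γ.Linked (fun v hv => ?_) (fun v hv => ?_)
  · rw [orbitDegree_congr (mem_filter.1 hv).2 (.refl p b), orbitDegree_eq_card_filter,
      bipartiteAbove, filter_filter]
  · rw [orbitDegree_congr (mem_filter.1 hv).2 (.refl p a), orbitDegree_eq_card_filter,
      bipartiteBelow, filter_filter]
    simp only [show ∀ u, Γ.Linked u v ↔ Γ.Linked v u from fun _ => ⟨.symm, .symm⟩]

theorem orbitDegree_pos_comm [Finite Γ.V] : 0 < orbitDegree p a b ↔ 0 < orbitDegree p b a := by
  rw [← Nat.mul_pos_iff_of_pos_right (period_pos p a), orbitDegree_mul_period,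
    Nat.mul_pos_iff_of_pos_right (period_pos p b)]

theorem orbitDegree_eq_zero_comm [Finite Γ.V] :
    orbitDegree p a b = 0 ↔ orbitDegree p b a = 0 := by
  simpa only [not_lt, Nat.le_zero] using (orbitDegree_pos_comm (p := p) (a := a) (b := b)).not

theorem Linked.pow_zero_smul (h : Γ.Linked a b) : Γ.Linked a (p ^ 0 • b) := by
  rwa [pow_zero, one_smul]

theorem Linked.orbitDegree_pos [Finite Γ.V] (h : Γ.Linked a b) : 0 < orbitDegree p a b :=
  card_pos.2 ⟨0, mem_residues.2 ⟨period_pos p b, h.pow_zero_smul⟩⟩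

theorem exists_residue (h : 0 < orbitDegree p a b) :
    ∃ r < MulAction.period p b, Γ.Linked a (p ^ r • b) := by
  obtain ⟨r, hr⟩ := card_pos.1 h
  exact ⟨r, mem_residues.1 hr⟩

theorem exists_residue_ne (h : 1 < orbitDegree p a b) (z : ℕ) :
    ∃ r ≠ z, r < MulAction.period p b ∧ Γ.Linked a (p ^ r • b) := by
  obtain ⟨r, hr, hrz⟩ := exists_mem_ne h z
  exact ⟨r, hrz, mem_residues.1 hr⟩

theorem exists_two_pos_residues (h : 2 < orbitDegree p a b) :
    ∃ r s, 0 < r ∧ r < s ∧ s < MulAction.period p b ∧ Γ.Linked a (p ^ r • b) ∧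
      Γ.Linked a (p ^ s • b) := by
  have hcard : 1 < #((residues p a b).erase 0) :=
    (Nat.lt_pred_iff.2 h).trans_le pred_card_le_card_erase
  obtain ⟨r, hr, s, hs, hrs⟩ := one_lt_card.1 hcard
  wlog hlt : r < s generalizing r s
  · exact this s hs r hr hrs.symm (by omega)
  rw [mem_erase, mem_residues] at hr hs
  exact ⟨r, s, by omega, hlt, hs.2.1, hr.2.2, hs.2.2⟩

theorem IsSimple.pos_of_linked_pow_smul (hs : Γ.IsSimple) {z : ℕ} (h : Γ.Linked a (p ^ z • a)) :
    0 < z := by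
  rw [Nat.pos_iff_ne_zero]
  rintro rfl
  rw [pow_zero, one_smul] at h
  exact hs.not_linked_self a h

theorem exists_loop_residue (hs : Γ.IsSimple) (h : 1 < orbitDegree p a a) :
    ∃ r, (0 < r ∧ r < MulAction.period p a ∧ 2 * r ≠ MulAction.period p a) ∧
      Γ.Linked a (p ^ r • a) := by
  obtain ⟨r, hne, hlt, hr⟩ := exists_residue_ne h (MulAction.period p a / 2)
  exact ⟨r, ⟨hs.pos_of_linked_pow_smul hr, hlt, by omega⟩, hr⟩

theorem linked_pow_period_sub_smul {z : ℕ} (hz : z ≤ MulAction.period p a)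
    (h : Γ.Linked a (p ^ z • a)) : Γ.Linked a (p ^ (MulAction.period p a - z) • a) := by
  rw [← linked_zpow_smul_iff (p := p) z, zpow_natCast, smul_smul, ← pow_add,
    Nat.add_sub_cancel' hz, MulAction.pow_period_smul]
  exact h.symm

/-- The involution `z ↦ m - z` of the residues, where `m` is the length of the orbit, has a fixed
point when their number is odd. -/
theorem two_dvd_period_of_odd (hs : Γ.IsSimple) (h : Odd (orbitDegree p a a)) :
    2 ∣ MulAction.period p a ∧ Γ.Linked a (p ^ (MulAction.period p a / 2) • a) := by
  set m := MulAction.period p a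
  obtain ⟨z, hz, hfix⟩ : ∃ z ∈ residues p a a, m - z = z := by
    by_contra! hne
    refine Nat.not_even_iff_odd.2 h ((ZMod.natCast_eq_zero_iff_even).1 ?_)
    rw [orbitDegree, ← nsmul_one, ← sum_const]
    refine sum_involution (fun z _ => m - z) (fun _ _ => by decide) (fun z hz _ => hne z hz)
      (fun z hz => ?_) fun z hz => Nat.sub_sub_self (mem_residues.1 hz).1.le
    obtain ⟨hlt, hz⟩ := mem_residues.1 hz
    have hpos := hs.pos_of_linked_pow_smul hz
    exact mem_residues.2 ⟨by omega, linked_pow_period_sub_smul hlt.le hz⟩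
  obtain ⟨hlt, hz⟩ := mem_residues.1 hz
  obtain rfl : m / 2 = z := by omega
  exact ⟨by omega, hz⟩

theorem end_orbit_cases (hs : Γ.IsSimple) (hsum : orbitDegree p a a + orbitDegree p a b = 3)
    (hpos : 0 < orbitDegree p a b) :
    (orbitDegree p a b = 1 ∧ ∃ r, (0 < r ∧ r < MulAction.period p a ∧
      2 * r ≠ MulAction.period p a) ∧ Γ.Linked a (p ^ r • a)) ∨
    (orbitDegree p a b = 2 ∧ 2 ∣ MulAction.period p a ∧
      Γ.Linked a (p ^ (MulAction.period p a / 2) • a)) ∨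
    orbitDegree p a b = 3 := by
  obtain h | h | h : orbitDegree p a b = 1 ∨ orbitDegree p a b = 2 ∨ orbitDegree p a b = 3 := by
    omega
  · exact .inl ⟨h, exists_loop_residue hs (by omega)⟩
  · exact .inr (.inl ⟨h, two_dvd_period_of_odd hs ⟨0, by omega⟩⟩)
  · exact .inr (.inr h)

theorem exists_orbitDegree_pos [Finite Γ.V] (hconn : Γ.Connected) {ι : Type*}
    {w : ι → Γ.V} (hw : IsTransversal p w) {i k : ι} (hik : i ≠ k) :
    ∃ j ≠ i, 0 < orbitDegree p (w i) (w j) := by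
  by_contra! h
  have closed (a b : Γ.V) (ha : SameOrbit p (w i) a) (hab : Γ.Linked a b) :
      SameOrbit p (w i) b := by
    obtain ⟨j, hj⟩ := hw.exists_sameOrbit b
    obtain rfl : j = i := by
      by_contra hji
      have := h j hji
      rw [orbitDegree_congr ha hj] at this
      exact this.not_gt hab.orbitDegree_pos
    exact hj
  have reach {v : Γ.V} (hv : Relation.ReflTransGen Γ.Linked (w i) v) : SameOrbit p (w i) v := by
    induction hv with
    | refl => exact .refl p (w i)
    | tail _ hab ih => exact closed _ _ ih hab
  exact hik (hw.eq_of_sameOrbit (reach (hconn (w i) (w k))))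

end DartGraph

namespace IsTransversal

variable {G α : Type*} [Group G] [MulAction G α] {p : G} {a b c : α}

theorem swap (h : IsTransversal p ![a, b]) : IsTransversal p ![b, a] := by
  have := h.comp (Equiv.swap 0 1)
  rwa [show ![a, b] ∘ Equiv.swap 0 1 = ![b, a] by ext i; fin_cases i <;> rfl] at this

theorem swap_left (h : IsTransversal p ![a, b, c]) : IsTransversal p ![b, a, c] := by
  have := h.comp (Equiv.swap 0 1)
  rwa [show ![a, b, c] ∘ Equiv.swap 0 1 = ![b, a, c] by ext i; fin_cases i <;> rfl] at this

theorem swap_right (h : IsTransversal p ![a, b, c]) : IsTransversal p ![a, c, b] := by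
  have := h.comp (Equiv.swap 1 2)
  rwa [show ![a, b, c] ∘ Equiv.swap 1 2 = ![a, c, b] by ext i; fin_cases i <;> rfl] at this

theorem reverse (h : IsTransversal p ![a, b, c]) : IsTransversal p ![c, b, a] :=
  h.swap_left.swap_right.swap_left

end IsTransversal

namespace DartGraph

open MulAction (period)

variable {Γ : DartGraph.{u, v}} {p : Γ.Aut} {x c y : Γ.V}

theorem sum_orbitDegree_three (hΓ : Γ.IsCubicNetwork) (hw : IsTransversal p ![x, c, y])
    (a : Γ.V) : orbitDegree p a x + orbitDegree p a c + orbitDegree p a y = 3 := by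
  have := hΓ.finite
  simpa [Fin.sum_univ_three] using sum_orbitDegree hΓ.cubic hΓ.simple hw a

/-- The vertices `x`, `c`, `y` represent the orbits and form a path with middle vertex `c`, so
that the edges from the orbit of `c` that they select get voltage `0`. -/
structure IsOrbitPath (p : Γ.Aut) (x c y : Γ.V) : Prop where
  transversal : IsTransversal p ![x, c, y]
  left : Γ.Linked x c
  right : Γ.Linked c y

namespace IsOrbitPath

theorem symm (h : IsOrbitPath p x c y) : IsOrbitPath p y c x :=
  ⟨h.transversal.reverse, h.right.symm, h.left.symm⟩

theorem left_cases (hP : IsOrbitPath p x c y) (hΓ : Γ.IsCubicNetwork)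
    (hxy : orbitDegree p x y = 0) :
    (orbitDegree p x c = 1 ∧ ∃ r, (0 < r ∧ r < period p x ∧ 2 * r ≠ period p x) ∧
      Γ.Linked x (p ^ r • x)) ∨
    (orbitDegree p x c = 2 ∧ 2 ∣ period p x ∧ Γ.Linked x (p ^ (period p x / 2) • x)) ∨
    orbitDegree p x c = 3 := by
  have := hΓ.finite
  refine end_orbit_cases hΓ.simple ?_ hP.left.orbitDegree_pos
  have := sum_orbitDegree_three hΓ hP.transversal x
  omega

theorem isListed_of_orbitDegree_one_one (hΓ : Γ.IsCubicNetwork) (hP : IsOrbitPath p x c y)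
    (hxy : orbitDegree p x y = 0) (hcx : orbitDegree p c x = 1) (hcy : orbitDegree p c y = 1) :
    Γ.IsListed := by
  have := hΓ.finite
  have hyx := orbitDegree_eq_zero_comm.1 hxy
  wlog hle : orbitDegree p y c ≤ orbitDegree p x c generalizing x y
  · exact this hP.symm hyx hcy hcx hxy (by omega)
  have hC := period_pos p c
  have hX := period_pos p x
  have balx := orbitDegree_mul_period p x c
  have baly := orbitDegree_mul_period p y c
  have l0 := hP.left.pow_zero_smul (p := p)
  have l1 := hP.right.pow_zero_smul (p := p)
  have l1' := hP.right.symm.pow_zero_smul (p := p)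
  have hcc : orbitDegree p c c = 1 := by have := sum_orbitDegree_three hΓ hP.transversal c; omega
  obtain ⟨hc2, lc⟩ := two_dvd_period_of_odd hΓ.simple (hcc ▸ odd_one)
  rcases hP.left_cases hΓ hxy with ⟨hx, r, hr, lr⟩ | ⟨hx, hx2, lx⟩ | hx <;>
    rcases hP.symm.left_cases hΓ hyx with ⟨hy, s, hs, ls⟩ | ⟨hy, hy2, ly⟩ | hy <;>
    simp only [hx, hy, hcx, hcy, one_mul, Nat.reduceLeDiff] at balx baly hle
  · exact isListed_of_realises hΓ 25 (period p c) r s (d := ⟨3, _, _⟩) rfl hC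
      (even_iff_two_dvd.2 hc2) hP.transversal ⟨l0, l1, lr, lc, ls⟩
  · exact isListed_of_realises hΓ 12 (period p x) s 0 (d := ⟨3, _, _⟩) rfl hX
      (even_iff_two_dvd.2 hx2) hP.transversal ⟨l0, l1, lx, lc, ls⟩
  · exact isListed_of_realises hΓ 9 (period p c) 0 0 (d := ⟨3, _, _⟩) rfl hC
      (show 4 ∣ _ by omega) hP.transversal.swap_right ⟨l0, l1', lx, ly, lc⟩
  · exact isListed_of_realises hΓ 13 (period p x) s 0 (d := ⟨3, _, _⟩) rfl hX
      (even_iff_two_dvd.2 (by omega)) hP.transversal ⟨l0, l1, lc, ls⟩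
  · exact isListed_of_realises hΓ 10 (period p x) 0 0 (d := ⟨3, _, _⟩) rfl hX
      (show 4 ∣ _ by omega) hP.transversal ⟨l0, l1, lc, ly⟩
  · exact isListed_of_realises hΓ 15 (period p c) 0 0 (d := ⟨3, _, _⟩) rfl hC
      (show 6 ∣ _ by omega) hP.transversal.swap_right ⟨l0, l1', lc⟩

theorem isListed_of_orbitDegree_one_two (hΓ : Γ.IsCubicNetwork) (hP : IsOrbitPath p x c y)
    (hxy : orbitDegree p x y = 0) (hcx : orbitDegree p c x = 1) (hcy : orbitDegree p c y = 2) :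
    Γ.IsListed := by
  have := hΓ.finite
  have hyx := orbitDegree_eq_zero_comm.1 hxy
  have hX := period_pos p x
  have hY := period_pos p y
  have balx := orbitDegree_mul_period p x c
  have baly := orbitDegree_mul_period p y c
  have l0 := hP.left.pow_zero_smul (p := p)
  have l1 := hP.right.pow_zero_smul (p := p)
  have l0' := hP.right.symm.pow_zero_smul (p := p)
  have l1' := hP.left.symm.pow_zero_smul (p := p)
  obtain ⟨t, ht, htY, lt⟩ := exists_residue_ne hcy.ge 0
  rcases hP.left_cases hΓ hxy with ⟨hx, r, hr, lr⟩ | ⟨hx, hx2, lx⟩ | hx <;>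
    rcases hP.symm.left_cases hΓ hyx with ⟨hy, s, hs, ls⟩ | ⟨hy, hy2, ly⟩ | hy <;>
    simp only [hx, hy, hcx, hcy, one_mul] at balx baly
  · exact isListed_of_realises hΓ 17 (period p x) r s (d := ⟨3, _, _⟩) rfl hX
      trivial hP.transversal ⟨l0, l1, lr, ls⟩
  · obtain ⟨t, ht, htC, lt⟩ := exists_residue_ne hy.ge 0
    exact isListed_of_realises hΓ 22 (period p y) t r (d := ⟨3, _, _⟩) rfl hY
      ⟨even_iff_two_dvd.2 hy2, ht⟩ hP.transversal.reverse ⟨l0', l1', lt, ly, lr⟩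
  · exact isListed_of_realises hΓ 14 (period p y) r 0 (d := ⟨3, _, _⟩) rfl hY
      (even_iff_two_dvd.2 (by omega)) hP.transversal.reverse ⟨l0', l1', lr⟩
  · exact isListed_of_realises hΓ 18 (period p x) s 0 (d := ⟨3, _, _⟩) rfl hX
      (even_iff_two_dvd.2 hx2) hP.transversal ⟨l0, l1, lx, ls⟩
  · exact isListed_of_realises hΓ 21 (period p x) t 0 (d := ⟨3, _, _⟩) rfl hX
      ⟨even_iff_two_dvd.2 hx2, ht⟩ hP.transversal ⟨l0, l1, lt, lx, ly⟩
  · exact isListed_of_realises hΓ 11 (period p y) 0 0 (d := ⟨3, _, _⟩) rfl hY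
      (show 8 ∣ _ by omega) hP.transversal.reverse ⟨l0', l1', lx⟩
  · exact isListed_of_realises hΓ 19 (period p x) s 0 (d := ⟨3, _, _⟩) rfl hX
      trivial hP.transversal ⟨l0, l1, ls⟩
  · exact isListed_of_realises hΓ 20 (period p x) t 0 (d := ⟨3, _, _⟩) rfl hX
      ⟨even_iff_two_dvd.2 (by omega), ht⟩ hP.transversal ⟨l0, l1, lt, ly⟩
  · exact isListed_of_realises hΓ 16 (period p x) 0 0 (d := ⟨3, _, _⟩) rfl hX
      trivial hP.transversal.swap_right ⟨l0, l0'⟩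

theorem isListed_of_path (hΓ : Γ.IsCubicNetwork) (hP : IsOrbitPath p x c y)
    (hxy : orbitDegree p x y = 0) : Γ.IsListed := by
  have := hΓ.finite
  have hyx := orbitDegree_eq_zero_comm.1 hxy
  have hsum := sum_orbitDegree_three hΓ hP.transversal c
  have hcx := hP.left.symm.orbitDegree_pos (p := p)
  have hcy := hP.right.orbitDegree_pos (p := p)
  obtain ⟨hx, hy⟩ | ⟨hx, hy⟩ | ⟨hx, hy⟩ : orbitDegree p c x = 1 ∧ orbitDegree p c y = 1 ∨
      orbitDegree p c x = 1 ∧ orbitDegree p c y = 2 ∨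
      orbitDegree p c x = 2 ∧ orbitDegree p c y = 1 := by
    omega
  · exact hP.isListed_of_orbitDegree_one_one hΓ hxy hx hy
  · exact hP.isListed_of_orbitDegree_one_two hΓ hxy hx hy
  · exact hP.symm.isListed_of_orbitDegree_one_two hΓ hyx hy hx

theorem triangle_cases (hΓ : Γ.IsCubicNetwork) (hP : IsOrbitPath p x c y)
    (hxy : 0 < orbitDegree p x y) (hcx : orbitDegree p c x = 1) (hcy : orbitDegree p c y = 1) :
    (period p x = period p c ∧ period p y = period p c ∧ orbitDegree p x x = 1 ∧
      orbitDegree p y y = 1) ∨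
    (period p x = period p c ∧ period p y = period p c ∧ orbitDegree p x y = 2) ∨
    (2 * period p x = period p c ∧ 2 * period p y = period p c) := by
  have := hΓ.finite
  have hC := period_pos p c
  have balx := orbitDegree_mul_period p x c
  have baly := orbitDegree_mul_period p y c
  have balxy := orbitDegree_mul_period p x y
  have hxc := hP.left.orbitDegree_pos (p := p)
  have hyc := hP.right.symm.orbitDegree_pos (p := p)
  have hyx := orbitDegree_pos_comm.1 hxy
  have hsumx := sum_orbitDegree_three hΓ hP.transversal x
  have hsumy := sum_orbitDegree_three hΓ hP.transversal y
  have cases {k l n : ℕ} (hk : 0 < k) (hl : 0 < l) (h : k + l + n = 3) :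
      (k = 1 ∧ l = 1) ∨ (k = 1 ∧ l = 2) ∨ (k = 2 ∧ l = 1) := by omega
  rcases cases hxc hxy (n := orbitDegree p x x) (by omega) with ⟨h, h'⟩ | ⟨h, h'⟩ | ⟨h, h'⟩ <;>
    rcases cases hyc hyx (n := orbitDegree p y y) (by omega) with
      ⟨h₁, h₁'⟩ | ⟨h₁, h₁'⟩ | ⟨h₁, h₁'⟩ <;>
    simp only [h, h', h₁, h₁', hcx, hcy] at balx baly balxy hsumx hsumy <;> omega

theorem isListed_of_triangle (hΓ : Γ.IsCubicNetwork) (hP : IsOrbitPath p x c y)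
    (hxy : 0 < orbitDegree p x y) (hcc : orbitDegree p c c = 1) : Γ.IsListed := by
  have := hΓ.finite
  have hC := period_pos p c
  have hX := period_pos p x
  have l0 := hP.left.pow_zero_smul (p := p)
  have l1 := hP.right.pow_zero_smul (p := p)
  have l1' := hP.right.symm.pow_zero_smul (p := p)
  obtain ⟨hc2, lc⟩ := two_dvd_period_of_odd hΓ.simple (hcc ▸ odd_one)
  obtain ⟨hcx, hcy⟩ : orbitDegree p c x = 1 ∧ orbitDegree p c y = 1 := by
    have := sum_orbitDegree_three hΓ hP.transversal c
    have := hP.left.symm.orbitDegree_pos (p := p)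
    have := hP.right.orbitDegree_pos (p := p)
    omega
  obtain ⟨r, hr, lr⟩ := exists_residue hxy
  rcases hP.triangle_cases hΓ hxy hcx hcy with ⟨hxC, hyC, hxx, hyy⟩ | ⟨hxC, hyC, hxy⟩ | ⟨hxC, hyC⟩
  · obtain ⟨-, lx⟩ := two_dvd_period_of_odd hΓ.simple (hxx ▸ odd_one)
    obtain ⟨-, ly⟩ := two_dvd_period_of_odd hΓ.simple (hyy ▸ odd_one)
    exact isListed_of_realises hΓ 24 (period p c) r 0 (d := ⟨3, _, _⟩) rfl hC
      (even_iff_two_dvd.2 hc2) hP.transversal ⟨l0, l1, lr, lx, lc, ly⟩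
  · obtain ⟨s, hsr, hs, ls⟩ := exists_residue_ne hxy.ge r
    exact isListed_of_realises hΓ 23 (period p c) r s (d := ⟨3, _, _⟩) rfl hC
      ⟨even_iff_two_dvd.2 hc2, hsr.symm⟩ hP.transversal ⟨l0, l1, lr, ls, lc⟩
  · exact isListed_of_realises hΓ 8 (period p x) r 0 (d := ⟨3, _, _⟩) rfl hX
      trivial hP.transversal.swap_right ⟨l0, l1', lr, lc⟩

end IsOrbitPath

theorem exists_isOrbitPath (hw : IsTransversal p ![x, c, y]) (hx : 0 < orbitDegree p c x)
    (hy : 0 < orbitDegree p c y) :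
    ∃ x' y', IsOrbitPath p x' c y' ∧ SameOrbit p x x' ∧ SameOrbit p y y' := by
  obtain ⟨r, -, hr⟩ := exists_residue hx
  obtain ⟨s, -, hs⟩ := exists_residue hy
  refine ⟨p ^ r • x, p ^ s • y, ⟨hw.congr ?_, hr.symm, hs⟩, .pow_smul p x r, .pow_smul p y s⟩
  simp [Fin.forall_fin_succ, SameOrbit.refl, SameOrbit.pow_smul]

theorem isListed_of_mutually_linked (hΓ : Γ.IsCubicNetwork) (hw : IsTransversal p ![x, c, y])
    (hxc : 0 < orbitDegree p x c) (hcy : 0 < orbitDegree p c y) (hxy : 0 < orbitDegree p x y) :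
    Γ.IsListed := by
  have := hΓ.finite
  have of_middle {x c y : Γ.V} (hw : IsTransversal p ![x, c, y]) (hcx : 0 < orbitDegree p c x)
      (hcy : 0 < orbitDegree p c y) (hxy : 0 < orbitDegree p x y)
      (hcc : orbitDegree p c c = 1) : Γ.IsListed := by
    obtain ⟨x', y', hP, hx, hy⟩ := exists_isOrbitPath hw hcx hcy
    exact hP.isListed_of_triangle hΓ (orbitDegree_congr hx hy ▸ hxy) hcc
  have hcx := orbitDegree_pos_comm.1 hxc
  have hyc := orbitDegree_pos_comm.1 hcy
  have hyx := orbitDegree_pos_comm.1 hxy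
  obtain h | h | h : orbitDegree p x x = 1 ∨ orbitDegree p c c = 1 ∨ orbitDegree p y y = 1 := by
    have hX := period_pos p x
    have balx := orbitDegree_mul_period p x c
    have balc := orbitDegree_mul_period p c y
    have baly := orbitDegree_mul_period p y x
    have hsum {a : Γ.V} := sum_orbitDegree_three hΓ hw a
    by_contra! hne
    -- Now every orbit has degrees `1` and `2` to the other two. Around the triangle the product
    -- of the degrees is the same in both directions, so their total product `8` is a square.
    have cases {k l n : ℕ} (hk : 0 < k) (hl : 0 < l) (h : k + l + n = 3) (hn : n ≠ 1) :
        (k = 1 ∧ l = 2) ∨ (k = 2 ∧ l = 1) := by omega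
    rcases cases hxc hxy (n := orbitDegree p x x) (by have := @hsum x; omega) hne.1 with
        ⟨h, h'⟩ | ⟨h, h'⟩ <;>
      rcases cases hcx hcy (n := orbitDegree p c c) (by have := @hsum c; omega) hne.2.1 with
        ⟨h₁, h₁'⟩ | ⟨h₁, h₁'⟩ <;>
      rcases cases hyx hyc (n := orbitDegree p y y) (by have := @hsum y; omega) hne.2.2 with
        ⟨h₂, h₂'⟩ | ⟨h₂, h₂'⟩ <;>
      simp only [h, h', h₁, h₁', h₂, h₂'] at balx balc baly <;> omega
  · exact of_middle hw.swap_left hxc hxy hcy h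
  · exact of_middle hw hcx hcy hxy h
  · exact of_middle hw.swap_right hyx hyc hxc h

theorem isListed_of_centre (hΓ : Γ.IsCubicNetwork) (hw : IsTransversal p ![x, c, y])
    (hcx : 0 < orbitDegree p c x) (hcy : 0 < orbitDegree p c y) : Γ.IsListed := by
  have := hΓ.finite
  obtain hxy | hxy := (orbitDegree p x y).eq_zero_or_pos
  · obtain ⟨x', y', hP, hx, hy⟩ := exists_isOrbitPath hw hcx hcy
    exact hP.isListed_of_path hΓ (orbitDegree_congr hx hy ▸ hxy)
  · exact isListed_of_mutually_linked hΓ hw (orbitDegree_pos_comm.1 hcx) hcy hxy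

theorem isListed_of_three_orbits (hΓ : Γ.IsCubicNetwork) (hw : IsTransversal p ![x, c, y]) :
    Γ.IsListed := by
  have := hΓ.finite
  have hx : 0 < orbitDegree p x c ∨ 0 < orbitDegree p x y := by
    simpa [Fin.exists_fin_succ] using
      exists_orbitDegree_pos hΓ.connected hw (i := 0) (k := 1) (by decide)
  have hc : 0 < orbitDegree p c x ∨ 0 < orbitDegree p c y := by
    simpa [Fin.exists_fin_succ] using
      exists_orbitDegree_pos hΓ.connected hw (i := 1) (k := 0) (by decide)
  have hy : 0 < orbitDegree p y x ∨ 0 < orbitDegree p y c := by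
    simpa [Fin.exists_fin_succ] using
      exists_orbitDegree_pos hΓ.connected hw (i := 2) (k := 0) (by decide)
  rcases hx with hxc | hxy
  · rcases hy with hyx | hyc
    · exact isListed_of_centre hΓ hw.swap_left hxc (orbitDegree_pos_comm.1 hyx)
    · exact isListed_of_centre hΓ hw (orbitDegree_pos_comm.1 hxc) (orbitDegree_pos_comm.1 hyc)
  · rcases hc with hcx | hcy
    · exact isListed_of_centre hΓ hw.swap_left (orbitDegree_pos_comm.1 hcx) hxy
    · exact isListed_of_centre hΓ hw.swap_right (orbitDegree_pos_comm.1 hxy)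
        (orbitDegree_pos_comm.1 hcy)

theorem isListed_of_linked (hΓ : Γ.IsCubicNetwork) (hw : IsTransversal p ![x, y])
    (hl : Γ.Linked x y) : Γ.IsListed := by
  have := hΓ.finite
  wlog hle : orbitDegree p y x ≤ orbitDegree p x y generalizing x y
  · exact this hw.swap hl.symm (by omega)
  have hX := period_pos p x
  have bal := orbitDegree_mul_period p x y
  have l0 := hl.pow_zero_smul (p := p)
  have hsum (a : Γ.V) : orbitDegree p a x + orbitDegree p a y = 3 := by
    simpa using sum_orbitDegree hΓ.cubic hΓ.simple hw a
  rcases end_orbit_cases hΓ.simple (hsum x) hl.orbitDegree_pos with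
      ⟨hx, r, hr, lr⟩ | ⟨hx, hx2, lx⟩ | hx <;>
    rcases end_orbit_cases hΓ.simple (add_comm _ _ |>.trans (hsum y)) hl.symm.orbitDegree_pos with
      ⟨hy, s, hs, ls⟩ | ⟨hy, hy2, ly⟩ | hy <;>
    simp only [hx, hy, one_mul, Nat.reduceLeDiff] at bal hle
  · exact isListed_of_realises hΓ 2 (period p x) r s (d := ⟨2, _, _⟩) rfl hX
      trivial hw ⟨l0, lr, ls⟩
  · exact isListed_of_realises hΓ 5 (period p x) s 0 (d := ⟨2, _, _⟩) rfl hX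
      (even_iff_two_dvd.2 hx2) hw ⟨l0, lx, ls⟩
  · obtain ⟨r, hr0, hr, lr⟩ := exists_residue_ne hx.ge 0
    exact isListed_of_realises hΓ 3 (period p x) r 0 (d := ⟨2, _, _⟩) rfl hX
      ⟨even_iff_two_dvd.2 hx2, hr0⟩ hw ⟨l0, lr, lx, ly⟩
  · exact isListed_of_realises hΓ 6 (period p x) s 0 (d := ⟨2, _, _⟩) rfl hX
      trivial hw ⟨l0, ls⟩
  · exact isListed_of_realises hΓ 7 (period p x) 0 0 (d := ⟨2, _, _⟩) rfl hX
      (show 4 ∣ _ by omega) hw ⟨l0, ly⟩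
  · obtain ⟨r, s, hr, hrs, hs, lr, ls⟩ := exists_two_pos_residues hx.ge
    exact isListed_of_realises hΓ 4 (period p x) r s (d := ⟨2, _, _⟩) rfl hX
      ⟨hr, hrs⟩ hw ⟨l0, lr, ls⟩

theorem isListed_of_two_orbits (hΓ : Γ.IsCubicNetwork) (hw : IsTransversal p ![x, y]) :
    Γ.IsListed := by
  have := hΓ.finite
  have hxy : 0 < orbitDegree p x y := by
    simpa using exists_orbitDegree_pos hΓ.connected hw (i := 0) (k := 1) (by decide)
  obtain ⟨r, -, hr⟩ := exists_residue hxy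
  refine isListed_of_linked hΓ (hw.congr ?_) hr
  simp [SameOrbit.refl, SameOrbit.pow_smul]

theorem isListed_of_one_orbit (hΓ : Γ.IsCubicNetwork) (hw : IsTransversal p ![x]) :
    Γ.IsListed := by
  have := hΓ.finite
  have hX := period_pos p x
  have hxx : orbitDegree p x x = 3 := by
    simpa using sum_orbitDegree hΓ.cubic hΓ.simple hw x
  obtain ⟨hx2, lx⟩ := two_dvd_period_of_odd hΓ.simple ⟨1, hxx⟩
  obtain ⟨r, hr, lr⟩ := exists_loop_residue hΓ.simple (a := x) (p := p) (by omega)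
  exact isListed_of_realises hΓ 1 (period p x) r 0 (d := ⟨1, _, _⟩) rfl hX
      (even_iff_two_dvd.2 hx2) hw ⟨lx, lr⟩

theorem isListed_of_cyclic (hΓ : Γ.IsCubicNetwork) (G : Subgroup Γ.Aut) [IsCyclic G]
    (hG : Nat.card (MulAction.orbitRel.Quotient G Γ.V) ≤ 3) : Γ.IsListed := by
  have := hΓ.finite
  obtain ⟨p, rfl⟩ := G.isCyclic_iff_exists_zpowers_eq_top.1 inferInstance
  obtain ⟨n, hn⟩ : ∃ n,
      Nat.card (MulAction.orbitRel.Quotient (Subgroup.zpowers p) Γ.V) = n := ⟨_, rfl⟩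
  obtain ⟨w, hw⟩ := IsTransversal.exists_of_card hn
  rw [hn] at hG
  rw [← FinVec.etaExpand_eq w] at hw
  interval_cases n
  · obtain ⟨a⟩ := Γ.nonempty
    exact (hw.exists_sameOrbit a).elim fun i => i.elim0
  · exact isListed_of_one_orbit hΓ hw
  · exact isListed_of_two_orbits hΓ hw
  · exact isListed_of_three_orbits hΓ hw

end DartGraph

theorem theorem4p1 (Γ : DartGraph.{u, v}) :
    (Finite Γ.V ∧ Γ.Connected ∧ Γ.IsCubic ∧ Γ.IsSimple ∧
      ∃ G : Subgroup Γ.Aut, IsCyclic G ∧ Nat.card (MulAction.orbitRel.Quotient G Γ.V) ≤ 3) ↔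
    ∃ i m r s : ℕ, ∃ h : Admissible i m r s, Nonempty (Γ.Iso (gammaGraph i m r s h)) := by
  constructor
  · rintro ⟨hfinite, hconnected, hcubic, hsimple, G, hG, hcard⟩
    exact DartGraph.isListed_of_cyclic ⟨hfinite, hconnected, hcubic, hsimple⟩ G hcard
  · rintro ⟨i, m, r, s, h, ⟨φ⟩⟩
    have hΓ := φ.symm.isCubicNetwork h.isCubicNetwork_gammaGraph
    exact ⟨hΓ.finite, hΓ.connected, hΓ.cubic, hΓ.simple, DartGraph.exists_isCyclic_of_iso φ.symm⟩
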